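/- Let $d\in\mathbb N$, let $\mu_0$ be a probability measure on $\mathbb R^d$, and for $r\in[1,\infty]$ let $\|\cdot\|_r$ be the $\ell^r$-norm on $\mathbb R^d$. Let $0<T\le\infty$. Assume **(H)** $\sigma:[0,T)\to[0,\infty)$ is continuous, strictly decreasing and differentiable (from the right at $0$), $\sigma'$ is bounded on $[0,t_0]$ for every $t_0\in(0,T)$, $\lim_{t\downarrow0}\sigma_t=1$, $\lim_{t\uparrow T}\sigma_t=0$, and $\beta_t=1-\sigma_t$. For $s>0$ put $\rho_s(x)=(2\pi s^2)^{-d/2}e^{-\|x\|_2^2/(2s^2)}$. For $t\in[0,T)$ put $$\phi_t(x)=\int_{\mathbb R^d}\rho_{\sigma_t}(x-\beta_ty)\,\mu_0(dy),\qquad \mathcal D_t^{\mu_0}(x)=\frac{\int y\,\rho_{\sigma_t}(x-\beta_ty)\,\mu_0(dy)}{\int\rho_{\sigma_t}(x-\beta_ty)\,\mu_0(dy)} .$$ For $p\in[1,\infty)$ let $$\mathcal W_{q,p}(\mu,\nu)=\inf_\gamma\Big(\int\|x-y\|_q^p\,\gamma(dx,dy)\Big)^{1/p},$$ the infimum being over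 all couplings $\gamma$ of $\mu$ and $\nu$. Let $\operatorname{erfc}(r)=\frac{2}{\sqrt\pi}\int_r^\infty e^{-x^2}dx$. **Theorem.** Let $Y_0$ and $\eta$ be independent random vectors in $\mathbb R^d$ on a probability space $(\Omega,\mathbb P)$, where $Y_0$ has i.i.d. standard normal components and $\eta\sim\mu_0$. Suppose that $\|\eta\|_q\le K$ almost surely for some $q\in[1,\infty]$ and $K\in\mathbb R$. Assume **(H)**. Then for every $\omega\in\Omega$ the ODE $$\frac{dY_t}{dt}=(\log\sigma_t)'\,\big[Y_t-\mathcal D_t^{\mu_0}(Y_t)\big],\qquad t\in[0,T),$$ with initial value $Y_0(\omega)$ has a unique solution on $[0,T)$ (with the right derivative at $t=0$), and $Y_t$ is a random vector for every $t\in[0,T)$. Moreover, for every $t\in[0,T)$: 1. The law $\mu_t$ of $Y_t$ has density $\phi_t$ with respect to Lebesgue measure, and it is the law of $\beta_t\eta+\sigma_t\xi$ for every $\xi\sim N(0,\mathbb I_d)$ on $\Omega$ that is independent of $\eta$. 2. For every $p\in[1,\infty)$, $\mathbb E\|Y_0\|_q^p<\infty$ and $$\mathcal W_{q,p}(\mu_t,\mu_0)\le\big[K+(\mathbb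 E\|Y_0\|_q^p)^{1/p}\big]\,\sigma_t .$$ 3. For every $z\in\mathbb R^d$ and every $\omega\in\Omega$, $$\|Y_t-\beta_tz\|_q\le\sigma_t\|Y_0\|_q+\beta_t\operatorname*{ess\,sup}\|\eta-z\|_q .$$ 4. For every $M>0$, $$\mathbb P\big(\|Y_t\|_\infty\ge\beta_t\operatorname*{ess\,sup}\|\eta\|_\infty+\sigma_tM\big)\le1-\big(1-\operatorname{erfc}(M/\sqrt2)\big)^d .$$ -/

import Mathlib

open MeasureTheory ProbabilityTheory Set Filter Topology
open scoped ENNReal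

namespace ProbFlow

/-- The state space `ℝ^d`; its norm `‖x‖` is the Euclidean norm `‖x‖₂`. -/
abbrev Space (d : ℕ) : Type := EuclideanSpace ℝ (Fin d)

/-- The `ℓ^q`-norm on `ℝ^d`, `q ∈ [1, ∞]` (for `q = ∞` the maximum norm). -/
noncomputable def lqNorm {d : ℕ} (q : ℝ≥0∞) (x : Space d) : ℝ :=
  ‖(WithLp.toLp q (WithLp.ofLp x) : PiLp q (fun _ : Fin d => ℝ))‖

/-- The time interval `[0, T)`, where `T` is finite or infinite. -/
def timeInterval (T : EReal) : Set ℝ := {t : ℝ | 0 ≤ t ∧ (t : EReal) < T}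

/-- The assumption **(H)** on `σ : [0, T) → [0, ∞)`. Only the values of `σ` on `[0, T)` matter;
the derivative at `0` is the right derivative. -/
structure HypH (T : EReal) (σ : ℝ → ℝ) : Prop where
  nonneg : ∀ t ∈ timeInterval T, 0 ≤ σ t
  continuousOn : ContinuousOn σ (timeInterval T)
  strictAntiOn : StrictAntiOn σ (timeInterval T)
  differentiableOn : DifferentiableOn ℝ σ (timeInterval T)
  deriv_bounded : ∀ t₀ : ℝ, 0 < t₀ → (t₀ : EReal) < T →
    ∃ C : ℝ, ∀ t ∈ Icc 0 t₀, |derivWithin σ (timeInterval T) t| ≤ C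
  tendsto_zero : Tendsto σ (𝓝[>] 0) (𝓝 1)
  tendsto_T : Tendsto σ (comap ((↑) : ℝ → EReal) (𝓝[<] T)) (𝓝 0)

/-- `β_t = 1 - σ_t`. -/
def beta (σ : ℝ → ℝ) (t : ℝ) : ℝ := 1 - σ t

/-- The density `ρ_s(x) = (2πs²)^{-d/2} exp(-‖x‖₂² / (2s²))` of `N(0, s² I_d)`. -/
noncomputable def rho {d : ℕ} (s : ℝ) (x : Space d) : ℝ :=
  (2 * Real.pi * s ^ 2) ^ (-(d : ℝ) / 2) * Real.exp (-(‖x‖ ^ 2 / (2 * s ^ 2)))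

/-- `φ_t(x) = ∫ ρ_{σ_t}(x - β_t y) μ₀(dy)`. -/
noncomputable def phi {d : ℕ} (σ : ℝ → ℝ) (μ₀ : Measure (Space d)) (t : ℝ) (x : Space d) : ℝ :=
  ∫ y, rho (σ t) (x - beta σ t • y) ∂μ₀

/-- `𝒟_t^{μ₀}(x) = E[η ρ_{σ_t}(x - β_t η)] / E[ρ_{σ_t}(x - β_t η)]`, where `η ∼ μ₀`. -/
noncomputable def denoiser {d : ℕ} (σ : ℝ → ℝ) (μ₀ : Measure (Space d)) (t : ℝ) (x : Space d) :
    Space d :=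
  (∫ y, rho (σ t) (x - beta σ t • y) ∂μ₀)⁻¹ • ∫ y, rho (σ t) (x - beta σ t • y) • y ∂μ₀

/-- The vector field `b_t^{μ₀}(x) = (log σ_t)' [x - 𝒟_t^{μ₀}(x)]` on `[0, T)`. -/
noncomputable def drift {d : ℕ} (T : EReal) (σ : ℝ → ℝ) (μ₀ : Measure (Space d)) (t : ℝ)
    (x : Space d) : Space d :=
  derivWithin (fun s => Real.log (σ s)) (timeInterval T) t • (x - denoiser σ μ₀ t x)

/-- `y` solves `dy/dt = b_t^{μ₀}(y)` on `[0, T)` with `y(0) = x₀` (right derivative at `0`). -/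
structure IsSolution {d : ℕ} (T : EReal) (σ : ℝ → ℝ) (μ₀ : Measure (Space d)) (x₀ : Space d)
    (y : ℝ → Space d) : Prop where
  init : y 0 = x₀
  ode : ∀ t ∈ timeInterval T, HasDerivWithinAt y (drift T σ μ₀ t (y t)) (timeInterval T) t

/-- `X ∼ N(0, I_d)`: the components of `X` are independent standard normal variables. -/
structure IsStdNormal {d : ℕ} {Ω : Type*} [MeasurableSpace Ω] (P : Measure Ω)
    (X : Ω → Space d) : Prop where
  measurable : Measurable X
  law : ∀ i, P.map (fun ω => X ω i) = gaussianReal 0 1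
  indep : iIndepFun (fun (i : Fin d) ω => X ω i) P

/-- The Wasserstein distance `𝒲_{q,p}(μ, ν)`: the infimum of `(∫ ‖x - y‖_q^p dγ)^{1/p}` over all
couplings `γ` of `μ` and `ν`. -/
noncomputable def wasserstein {d : ℕ} (q : ℝ≥0∞) (p : ℝ) (μ ν : Measure (Space d)) : ℝ≥0∞ :=
  ⨅ γ ∈ {γ : Measure (Space d × Space d) | γ.map Prod.fst = μ ∧ γ.map Prod.snd = ν},
    (∫⁻ z, ENNReal.ofReal (lqNorm q (z.1 - z.2) ^ p) ∂γ) ^ (1 / p)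

/-- `erfc(r) = (2/√π) ∫_r^∞ exp(-x²) dx`. -/
noncomputable def erfc (r : ℝ) : ℝ := 2 / √Real.pi * ∫ x in Ioi r, Real.exp (-x ^ 2)

end ProbFlow

open ProbFlow

/-! The substitution x = y/σ_t, u = β_t/σ_t = 1/σ_t - 1 removes the linear term of the ODE. Since
du/dt = -σ'/σ², it becomes dx/du = m_u(x), where m_u(x) is the mean of μ₀ reweighted by exp(u⟨x,y⟩ -
u²‖y‖²/2): after completing the square, the Gaussian kernel in the denoiser is this tilt up to a
factor not depending on y. As μ₀ has bounded support, m is bounded by some R and Lipschitz in x with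
constant 2|u|R², so it has a global flow Φ (`exists_tiltMean_flow`), and Y_t = σ_t Φ(0, Y_0, u).
Uniqueness is Grönwall's inequality in the new variable (`isSolution_unique`).

For the law, let g_u be the density of uη + ξ. It satisfies the continuity equation ∂_u g + div(g m)
= 0 (`gaussMixLineDeriv_zero`, where the divergence of m is u times a variance). To conclude that Φ
transports g without differentiating Φ in its initial value, fix a bounded Lipschitz e and show that
s ↦ ∫ g_s(x) e(Φ(s,x,U)) dx has zero derivative. At time s + h, change variables by the Euler step x
↦ x + h m_s(x), a bijection for small h. The transported density including the Jacobian is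
stationary at h = 0 by the continuity equation; the argument of e is stationary because Euler step
and flow differ by o(h) and Φ(s+h,·,U) is Lipschitz uniformly in h. Gaussian envelopes dominate the
difference quotients. Comparing s = 0 with s = U for characters e identifies the characteristic
functions, hence the laws (`map_smul_flow_eq`).

The other claims follow. The coupling of β_tη + σ_tY_0 with η has difference σ_t(Y_0 - η), and
Minkowski's inequality gives the Wasserstein bound. The curve Φ - uz has velocity m - z, an average
of y - z, which gives the pathwise bound; its case z = 0 in the maximum norm reduces the tail to
that of Y_0. -/

namespace ProbFlow

/-! ### Global integral curves of bounded, locally Lipschitz fields -/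

section GlobalFlow

variable {E : Type*} [NormedAddCommGroup E] [NormedSpace ℝ E]

/-- A vector field which is Lipschitz in space, locally uniformly in time. -/
def LocLipschitzField (v : ℝ → E → E) : Prop :=
  ∀ N : ℝ, ∃ K : NNReal, ∀ t, |t| ≤ N → LipschitzWith K (v t)

theorem dist_integralCurve_le_of_le {v : ℝ → E → E} {K : NNReal} {a b : ℝ} (hab : a ≤ b)
    (hv : ∀ t ∈ Icc a b, LipschitzWith K (v t)) {f g : ℝ → E}
    (hf : IsIntegralCurve f v) (hg : IsIntegralCurve g v) :
    dist (f b) (g b) ≤ dist (f a) (g a) * Real.exp (K * (b - a)) :=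
  dist_le_of_trajectories_ODE_of_mem (s := fun _ => univ)
    (fun t ht => (hv t (Ico_subset_Icc_self ht)).lipschitzOnWith) hf.continuous.continuousOn
    (fun t _ => (hf t).hasDerivWithinAt) (fun _ _ => trivial) hg.continuous.continuousOn
    (fun t _ => (hg t).hasDerivWithinAt) (fun _ _ => trivial) le_rfl b (right_mem_Icc.2 hab)

theorem IsIntegralCurve.comp_neg_time {v : ℝ → E → E} {f : ℝ → E} (hf : IsIntegralCurve f v) :
    IsIntegralCurve (fun t => f (-t)) (fun t x => -v (-t) x) := by
  intro t
  have := (hf (-t)).scomp t (hasDerivAt_neg t)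
  simpa [Function.comp_def] using this

/-- Grönwall's inequality forward in time, and for b < a the same for the time-reversed curves. Both
directions are needed because the flow is followed between arbitrary real times. -/
theorem dist_integralCurve_le {v : ℝ → E → E} {K : NNReal} {N : ℝ}
    (hv : ∀ t, |t| ≤ N → LipschitzWith K (v t)) {f g : ℝ → E}
    (hf : IsIntegralCurve f v) (hg : IsIntegralCurve g v) {a b : ℝ} (ha : |a| ≤ N) (hb : |b| ≤ N) :
    dist (f b) (g b) ≤ dist (f a) (g a) * Real.exp (K * |b - a|) := by
  rw [abs_le] at ha hb
  rcases le_total a b with h | h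
  · rw [abs_of_nonneg (sub_nonneg.2 h)]
    exact dist_integralCurve_le_of_le h
      (fun t ht => hv t (abs_le.2 ⟨ha.1.trans ht.1, ht.2.trans hb.2⟩)) hf hg
  · have hv' : ∀ t ∈ Icc (-a) (-b), LipschitzWith K (fun x => -v (-t) x) := fun t ht => by
      refine (hv (-t) (abs_le.2 ⟨?_, ?_⟩)).neg
      · linarith [ht.2]
      · linarith [ht.1]
    have := dist_integralCurve_le_of_le (neg_le_neg h) hv' hf.comp_neg_time hg.comp_neg_time
    rw [abs_of_nonpos (sub_nonpos.2 h)]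
    simpa [add_comm, sub_eq_add_neg] using this

theorem integralCurve_unique {v : ℝ → E → E} (hv : LocLipschitzField v) {f g : ℝ → E}
    (hf : IsIntegralCurve f v) (hg : IsIntegralCurve g v) {a : ℝ} (h : f a = g a) : f = g := by
  funext b
  obtain ⟨K, hK⟩ := hv (max |a| |b|)
  have := dist_integralCurve_le hK hf hg (le_max_left _ _) (le_max_right _ _)
  rw [h, dist_self, zero_mul] at this
  exact dist_le_zero.1 this

/-- A speed bound valid everywhere makes Picard–Lindelöf work at once on the whole interval of
radius n + 1: a ball of radius R(n + 1) cannot be left. The solutions agree by uniqueness and are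
glued. -/
theorem exists_integralCurve [CompleteSpace E] {v : ℝ → E → E} (hv : LocLipschitzField v)
    (hcont : ∀ x, Continuous fun t => v t x) {R : ℝ} (hR : ∀ t x, ‖v t x‖ ≤ R) (s : ℝ) (x : E) :
    ∃ α : ℝ → E, α s = x ∧ IsIntegralCurve α v := by
  have hR0 : 0 ≤ R := (norm_nonneg _).trans (hR 0 0)
  have loc : ∀ n : ℕ, ∃ α : ℝ → E, α s = x ∧
      ∀ t ∈ Ioo (s - (n + 1)) (s + (n + 1)), HasDerivAt α (v t (α t)) t := by
    intro n
    have hn : (0 : ℝ) < n + 1 := by positivity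
    obtain ⟨K, hK⟩ := hv (|s| + (n + 1))
    have hpl : IsPicardLindelof v (tmin := s - (n + 1)) (tmax := s + (n + 1))
        ⟨s, by constructor <;> linarith⟩ x ⟨R * (n + 1), by positivity⟩ 0 ⟨R, hR0⟩ K :=
      { lipschitzOnWith := fun t ht => (hK t (by
          rcases abs_cases s with h | h <;>
            exact abs_le.2 ⟨by linarith [ht.1], by linarith [ht.2]⟩)).lipschitzOnWith
        continuousOn := fun y _ => (hcont y).continuousOn
        norm_le := fun t _ y _ => hR t y
        mul_max_le := by simp; rfl }
    obtain ⟨α, h1, h2⟩ := hpl.exists_eq_forall_mem_Icc_hasDerivWithinAt₀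
    exact ⟨α, h1, fun t ht => (h2 t (Ioo_subset_Icc_self ht)).hasDerivAt (Icc_mem_nhds ht.1 ht.2)⟩
  choose α hα0 hα using loc
  have agree : ∀ m n : ℕ, m ≤ n → ∀ t ∈ Ioo (s - (m + 1)) (s + (m + 1)), α m t = α n t := by
    intro m n hmn
    have hmn' : (m : ℝ) ≤ n := by exact_mod_cast hmn
    have hm : (0 : ℝ) < m + 1 := by positivity
    obtain ⟨K, hK⟩ := hv (|s| + (m + 1))
    refine ODE_solution_unique_of_mem_Ioo (K := K) (s := fun _ => univ) (t₀ := s) (v := v)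
      (fun t ht => (hK t ?_).lipschitzOnWith) ⟨by linarith, by linarith⟩
      (fun t ht => ⟨hα m t ht, trivial⟩)
      (fun t ht => ⟨hα n t ⟨by linarith [ht.1], by linarith [ht.2]⟩, trivial⟩)
      ((hα0 m).trans (hα0 n).symm)
    rcases abs_cases s with h | h <;> exact abs_le.2 ⟨by linarith [ht.1], by linarith [ht.2]⟩
  have mem : ∀ (n : ℕ) t, |t - s| < n + 1 → t ∈ Ioo (s - (n + 1)) (s + (n + 1)) := by
    intro n t h
    rw [abs_lt] at h
    exact ⟨by linarith, by linarith⟩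
  -- The index ⌈|t - s|⌉ suffices since the interval of index n has radius n + 1, so t is an
  -- interior point.
  let β : ℝ → E := fun t => α ⌈|t - s|⌉₊ t
  have hβ : ∀ (n : ℕ) t, |t - s| < n + 1 → β t = α n t := by
    intro n t h
    have h1 : |t - s| < (⌈|t - s|⌉₊ : ℝ) + 1 := by linarith [Nat.le_ceil |t - s|]
    rcases le_total n ⌈|t - s|⌉₊ with h' | h'
    · exact (agree _ _ h' t (mem _ _ h)).symm
    · exact agree _ _ h' t (mem _ _ h1)
  refine ⟨β, ?_, fun t => ?_⟩
  · rw [hβ 0 s (by simp), hα0]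
  · have h1 : |t - s| < (⌈|t - s|⌉₊ : ℝ) + 1 := by linarith [Nat.le_ceil |t - s|]
    have hev : β =ᶠ[𝓝 t] α ⌈|t - s|⌉₊ := by
      have : ∀ᶠ r in 𝓝 t, |r - s| < (⌈|t - s|⌉₊ : ℝ) + 1 :=
        (show Continuous fun r : ℝ => |r - s| by fun_prop).continuousAt.eventually_lt
          continuousAt_const h1
      filter_upwards [this] with r hr using hβ _ r hr
    exact (hα _ t (mem _ _ h1)).congr_of_eventuallyEq hev

end GlobalFlow
-- The tilted mean: bounds, derivative and divergence
section Tilt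

variable {d : ℕ} {V : Type*} [NormedAddCommGroup V] [NormedSpace ℝ V]

/-- The exponential tilt `exp (u ⟨x, y⟩ - u² ‖y‖² / 2)`. -/
noncomputable def tilt (u : ℝ) (x y : Space d) : ℝ :=
  Real.exp (u * inner ℝ x y - u ^ 2 * ‖y‖ ^ 2 / 2)

theorem tilt_pos (u : ℝ) (x y : Space d) : 0 < tilt u x y := Real.exp_pos _

theorem continuous_tilt : Continuous fun p : (ℝ × Space d) × Space d => tilt p.1.1 p.1.2 p.2 := by
  unfold tilt
  fun_prop

theorem continuous_tilt_right (u : ℝ) (x : Space d) : Continuous fun y => tilt u x y := by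
  unfold tilt
  fun_prop

theorem hasFDerivAt_tilt (u : ℝ) (x y : Space d) :
    HasFDerivAt (fun x => tilt u x y) (tilt u x y • (u • innerSL ℝ y)) x := by
  have h : HasFDerivAt (fun x : Space d => u * inner ℝ x y - u ^ 2 * ‖y‖ ^ 2 / 2)
      (u • innerSL ℝ y) x := by
    have h1 := ((innerSL ℝ y).hasFDerivAt (x := x)).const_mul u
    have h2 := h1.sub_const (u ^ 2 * ‖y‖ ^ 2 / 2)
    refine h2.congr_of_eventuallyEq (Eventually.of_forall fun z => ?_)
    simp [real_inner_comm]
  exact h.exp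

/-- The tilted integral of `c`. -/
noncomputable def tiltInt (μ : Measure (Space d)) (c : Space d → V) (u : ℝ) (x : Space d) : V :=
  ∫ y, tilt u x y • c y ∂μ

variable {μ : Measure (Space d)} {R : ℝ}

/-- Reduces integrals to a compact ball, where continuous functions are integrable and parametric
integrals are continuous. -/
theorem restrict_closedBall_eq (hR : ∀ᵐ y ∂μ, ‖y‖ ≤ R) :
    μ.restrict (Metric.closedBall 0 R) = μ :=
  Measure.restrict_eq_self_of_ae_mem (by simpa using hR)

theorem continuous_smul_innerSL_smulRight (u : ℝ) {c : Space d → V} (hc : Continuous c) :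
    Continuous fun y => (u • innerSL ℝ y : Space d →L[ℝ] ℝ).smulRight (c y) :=
  (ContinuousLinearMap.smulRightL ℝ (Space d) V).continuous₂.comp
    (((innerSL ℝ).continuous.const_smul u).prodMk hc)

variable [IsProbabilityMeasure μ]

theorem integrable_of_continuous {V : Type*} [NormedAddCommGroup V] (hR : ∀ᵐ y ∂μ, ‖y‖ ≤ R)
    {f : Space d → V} (hf : Continuous f) :
    Integrable f μ := by
  rw [← restrict_closedBall_eq hR]
  exact hf.continuousOn.integrableOn_compact (isCompact_closedBall 0 R)

theorem integrable_tilt_smul (hR : ∀ᵐ y ∂μ, ‖y‖ ≤ R) {c : Space d → V} (hc : Continuous c)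
    (u : ℝ) (x : Space d) : Integrable (fun y => tilt u x y • c y) μ :=
  integrable_of_continuous hR ((continuous_tilt_right u x).smul hc)

theorem integrable_tilt (hR : ∀ᵐ y ∂μ, ‖y‖ ≤ R) (u : ℝ) (x : Space d) :
    Integrable (fun y => tilt u x y) μ :=
  integrable_of_continuous hR (continuous_tilt_right u x)

theorem continuous_tiltInt (hR : ∀ᵐ y ∂μ, ‖y‖ ≤ R) {c : Space d → V} (hc : Continuous c) :
    Continuous fun p : ℝ × Space d => tiltInt μ c p.1 p.2 := by
  have h := continuous_parametric_integral_of_continuous (μ := μ)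
    (f := fun (p : ℝ × Space d) y => tilt p.1 p.2 y • c y)
    (continuous_tilt.smul (hc.comp continuous_snd)) (isCompact_closedBall (0 : Space d) R)
  rwa [restrict_closedBall_eq hR] at h

theorem tilt_le {u : ℝ} {x y : Space d} {R ρ : ℝ} (hy : ‖y‖ ≤ R) (hx : ‖x‖ ≤ ρ) :
    tilt u x y ≤ Real.exp (|u| * (ρ * R)) := by
  refine Real.exp_le_exp.2 ?_
  have h1 : u * inner ℝ x y ≤ |u| * (ρ * R) := by
    refine (le_abs_self _).trans ?_
    rw [abs_mul]
    gcongr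
    exact (abs_real_inner_le_norm x y).trans (by gcongr; exact (norm_nonneg _).trans hx)
  have h2 : 0 ≤ u ^ 2 * ‖y‖ ^ 2 / 2 := by positivity
  linarith

theorem hasFDerivAt_tiltInt (hR : ∀ᵐ y ∂μ, ‖y‖ ≤ R) {c : Space d → V} (hc : Continuous c)
    (u : ℝ) (x : Space d) :
    HasFDerivAt (tiltInt μ c u)
      (tiltInt μ (fun y => (u • innerSL ℝ y : Space d →L[ℝ] ℝ).smulRight (c y)) u x) x := by
  obtain ⟨C, hC⟩ := (isCompact_closedBall (0 : Space d) R).exists_bound_of_continuousOn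
    (f := fun y => (u • innerSL ℝ y : Space d →L[ℝ] ℝ).smulRight (c y))
    (continuous_smul_innerSL_smulRight u hc).continuousOn
  refine hasFDerivAt_integral_of_dominated_of_fderiv_le (μ := μ) (𝕜 := ℝ)
    (F := fun x y => tilt u x y • c y)
    (F' := fun x y => tilt u x y • (u • innerSL ℝ y : Space d →L[ℝ] ℝ).smulRight (c y))
    (bound := fun _ => Real.exp (|u| * ((‖x‖ + 1) * R)) * C)
    (Metric.ball_mem_nhds x one_pos)
    (Eventually.of_forall fun z => (integrable_tilt_smul hR hc u z).aestronglyMeasurable)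
    (integrable_tilt_smul hR hc u x)
    (integrable_tilt_smul hR (continuous_smul_innerSL_smulRight u hc) u x).aestronglyMeasurable
    ?_ (integrable_const _) ?_
  · filter_upwards [hR] with y hy z hz
    have hz' : ‖z‖ ≤ ‖x‖ + 1 := by
      have := norm_le_norm_add_norm_sub' z x
      rw [Metric.mem_ball, dist_eq_norm] at hz
      linarith
    rw [norm_smul, Real.norm_of_nonneg (tilt_pos _ _ _).le]
    have := hC y (by simpa using hy)
    gcongr
    exact tilt_le hy hz'
  · refine Eventually.of_forall fun y z _ => ?_
    have := (hasFDerivAt_tilt u z y).smul_const (c y)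
    convert this using 1
    ext w
    simp [mul_smul]

/-- The normalizing constant of the tilted measure. -/
noncomputable def tiltMass (μ : Measure (Space d)) (u : ℝ) (x : Space d) : ℝ := ∫ y, tilt u x y ∂μ

theorem tiltMass_pos (hR : ∀ᵐ y ∂μ, ‖y‖ ≤ R) (u : ℝ) (x : Space d) : 0 < tiltMass μ u x :=
  integral_exp_pos (integrable_tilt hR u x)

theorem norm_tiltInt_le (hR : ∀ᵐ y ∂μ, ‖y‖ ≤ R) {c : Space d → V} {C : ℝ}
    (hC : ∀ᵐ y ∂μ, ‖c y‖ ≤ C) (u : ℝ) (x : Space d) :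
    ‖tiltInt μ c u x‖ ≤ tiltMass μ u x * C := by
  rw [tiltMass, ← integral_mul_const]
  refine norm_integral_le_of_norm_le ((integrable_tilt hR u x).mul_const C) ?_
  filter_upwards [hC] with y hy
  rw [norm_smul, Real.norm_of_nonneg (tilt_pos _ _ _).le]
  exact mul_le_mul_of_nonneg_left hy (tilt_pos _ _ _).le

/-- The mean of the tilted probability measure. -/
noncomputable def tiltMean (μ : Measure (Space d)) (u : ℝ) (x : Space d) : Space d :=
  (tiltMass μ u x)⁻¹ • tiltInt μ (fun y => y) u x

theorem tiltInt_id (hR : ∀ᵐ y ∂μ, ‖y‖ ≤ R) (u : ℝ) (x : Space d) :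
    tiltInt μ (fun y => y) u x = tiltMass μ u x • tiltMean μ u x := by
  rw [tiltMean, smul_inv_smul₀ (tiltMass_pos hR u x).ne']

theorem tiltMass_eq (μ : Measure (Space d)) : tiltMass μ = tiltInt μ (fun _ => (1 : ℝ)) := by
  funext u x
  simp [tiltMass, tiltInt]

theorem continuous_tiltMass (hR : ∀ᵐ y ∂μ, ‖y‖ ≤ R) :
    Continuous fun p : ℝ × Space d => tiltMass μ p.1 p.2 := by
  rw [tiltMass_eq]
  exact continuous_tiltInt hR continuous_const

theorem continuous_tiltMean (hR : ∀ᵐ y ∂μ, ‖y‖ ≤ R) :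
    Continuous fun p : ℝ × Space d => tiltMean μ p.1 p.2 :=
  ((continuous_tiltMass hR).inv₀ fun p => (tiltMass_pos hR p.1 p.2).ne').smul
    (continuous_tiltInt hR continuous_id)

theorem norm_tiltMean_le (hR : ∀ᵐ y ∂μ, ‖y‖ ≤ R) (u : ℝ) (x : Space d) :
    ‖tiltMean μ u x‖ ≤ R := by
  have hZ := tiltMass_pos hR u x
  rw [tiltMean, norm_smul, norm_inv, Real.norm_of_nonneg hZ.le, inv_mul_le_iff₀ hZ]
  exact norm_tiltInt_le hR hR u x

/-- The spatial derivative of the tilted mean. -/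
noncomputable def tiltMeanDeriv (μ : Measure (Space d)) (u : ℝ) (x : Space d) :
    Space d →L[ℝ] Space d :=
  (tiltMass μ u x)⁻¹ • (tiltInt μ (fun y => (u • innerSL ℝ y : Space d →L[ℝ] ℝ).smulRight y) u x -
    (u • innerSL ℝ (tiltInt μ (fun y => y) u x) : Space d →L[ℝ] ℝ).smulRight (tiltMean μ u x))

theorem hasFDerivAt_tiltMass (hR : ∀ᵐ y ∂μ, ‖y‖ ≤ R) (u : ℝ) (x : Space d) :
    HasFDerivAt (tiltMass μ u) (u • innerSL ℝ (tiltInt μ (fun y => y) u x)) x := by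
  have h := hasFDerivAt_tiltInt hR (c := fun _ => (1 : ℝ)) continuous_const u x
  rw [← tiltMass_eq] at h
  refine h.congr_fderiv ?_
  have h2 := (innerSL ℝ (E := Space d)).integral_comp_comm
    (integrable_tilt_smul hR continuous_id' u x)
  simp only [tiltInt]
  rw [← h2, ← integral_smul]
  refine integral_congr_ae (Eventually.of_forall fun y => ?_)
  ext w
  simp only [map_smul, _root_.smul_apply, ContinuousLinearMap.smulRight_apply, smul_eq_mul, mul_one]
  ring

theorem hasFDerivAt_tiltMean (hR : ∀ᵐ y ∂μ, ‖y‖ ≤ R) (u : ℝ) (x : Space d) :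
    HasFDerivAt (tiltMean μ u) (tiltMeanDeriv μ u x) x := by
  have hZ := (tiltMass_pos hR u x).ne'
  have h1 := (hasDerivAt_inv hZ).comp_hasFDerivAt x (hasFDerivAt_tiltMass hR u x)
  have h2 := h1.smul (hasFDerivAt_tiltInt hR (c := fun y => y) continuous_id' u x)
  refine h2.congr_fderiv ?_
  ext1 w
  simp only [tiltMeanDeriv, tiltMean, add_apply,
    _root_.smul_apply, sub_apply,
    ContinuousLinearMap.smulRight_apply, smul_sub, smul_smul, smul_eq_mul]
  rw [sub_eq_add_neg, ← neg_smul]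
  congr 2
  field_simp

/-- The derivative is u times the covariance of the tilted law, second moment minus product of
means; each of the two terms is at most |u|R². -/
theorem norm_tiltMeanDeriv_le (hR : ∀ᵐ y ∂μ, ‖y‖ ≤ R) (u : ℝ) (x : Space d) :
    ‖tiltMeanDeriv μ u x‖ ≤ 2 * (|u| * R ^ 2) := by
  have hZ := tiltMass_pos hR u x
  have hm := norm_tiltMean_le hR u x
  have hR0 : 0 ≤ R := (norm_nonneg _).trans hm
  rw [tiltMeanDeriv, norm_smul, norm_inv, Real.norm_of_nonneg hZ.le, inv_mul_le_iff₀ hZ]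
  refine (norm_sub_le _ _).trans ?_
  have h1 : ‖tiltInt μ (fun y => (u • innerSL ℝ y : Space d →L[ℝ] ℝ).smulRight y) u x‖ ≤
      tiltMass μ u x * (|u| * R ^ 2) := by
    refine norm_tiltInt_le hR ?_ u x
    filter_upwards [hR] with y hy
    rw [ContinuousLinearMap.norm_smulRight_apply, norm_smul, innerSL_apply_norm, Real.norm_eq_abs,
      mul_assoc, sq]
    gcongr
  have h2 : ‖(u • innerSL ℝ (tiltInt μ (fun y => y) u x) : Space d →L[ℝ] ℝ).smulRight
      (tiltMean μ u x)‖ ≤ tiltMass μ u x * (|u| * R ^ 2) := by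
    rw [ContinuousLinearMap.norm_smulRight_apply, norm_smul, innerSL_apply_norm, Real.norm_eq_abs]
    calc _ ≤ |u| * (tiltMass μ u x * R) * R := by
          gcongr
          exact norm_tiltInt_le hR hR u x
      _ = _ := by ring
  linarith

theorem lipschitzWith_tiltMean (hR : ∀ᵐ y ∂μ, ‖y‖ ≤ R) (u : ℝ) :
    LipschitzWith (2 * (|u| * R ^ 2)).toNNReal (tiltMean μ u) := by
  refine lipschitzWith_of_nnnorm_fderiv_le (𝕜 := ℝ)
    (fun x => (hasFDerivAt_tiltMean hR u x).differentiableAt) fun x => ?_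
  rw [(hasFDerivAt_tiltMean hR u x).fderiv, ← NNReal.coe_le_coe, coe_nnnorm,
    Real.coe_toNNReal _ (by positivity)]
  exact norm_tiltMeanDeriv_le hR u x

theorem locLipschitzField_tiltMean (hR : ∀ᵐ y ∂μ, ‖y‖ ≤ R) : LocLipschitzField (tiltMean μ) :=
  fun N => ⟨(2 * (N * R ^ 2)).toNNReal, fun t ht => (lipschitzWith_tiltMean hR t).weaken
    (Real.toNNReal_le_toNNReal (by gcongr))⟩

/-- The trace of the covariance is the variance E‖y‖² - ‖Ey‖² under the tilted law. Multiplying by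
the mass avoids divisions later. -/
theorem trace_tiltMeanDeriv (hR : ∀ᵐ y ∂μ, ‖y‖ ≤ R) (u : ℝ) (x : Space d) :
    tiltMass μ u x * LinearMap.trace ℝ _ (tiltMeanDeriv μ u x : Space d →ₗ[ℝ] Space d) =
      u * (tiltInt μ (fun y => ‖y‖ ^ 2) u x - tiltMass μ u x * ‖tiltMean μ u x‖ ^ 2) := by
  have hZ := tiltMass_pos hR u x
  let tr : (Space d →L[ℝ] Space d) →L[ℝ] ℝ :=
    LinearMap.toContinuousLinearMap
      ((LinearMap.trace ℝ (Space d)).comp (ContinuousLinearMap.coeLM ℝ))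
  have htr : ∀ A : Space d →L[ℝ] Space d,
    LinearMap.trace ℝ _ (A : Space d →ₗ[ℝ] Space d) = tr A := fun A => rfl
  have htr1 : ∀ (f : Space d →L[ℝ] ℝ) (y : Space d), tr (f.smulRight y) = f y := by
    intro f y
    rw [← htr]
    exact LinearMap.trace_smulRight (f : Space d →ₗ[ℝ] ℝ) y
  have h1 : tr (tiltInt μ (fun y => (u • innerSL ℝ y : Space d →L[ℝ] ℝ).smulRight y) u x) =
      u * tiltInt μ (fun y => ‖y‖ ^ 2) u x := by
    rw [tiltInt, ← tr.integral_comp_comm (integrable_tilt_smul hR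
      (continuous_smul_innerSL_smulRight u continuous_id') u x), tiltInt, ← integral_const_mul]
    refine integral_congr_ae (Eventually.of_forall fun y => ?_)
    simp [htr1]
    ring
  rw [htr, tiltMeanDeriv, map_smul, map_sub, h1, htr1, tiltInt_id hR]
  simp
  field_simp

end Tilt
-- The determinant near the identity
section Det

variable {d : ℕ}

theorem contDiff_det : ContDiff ℝ 1 fun A : Space d →L[ℝ] Space d => A.det := by
  have b := (EuclideanSpace.basisFun (Fin d) ℝ).toBasis
  have h : (fun A : Space d →L[ℝ] Space d => A.det) = fun A =>
      ∑ τ : Equiv.Perm (Fin d), ((Equiv.Perm.sign τ : ℤ) : ℝ) *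
        ∏ i, (b.coord (τ i)).toContinuousLinearMap (A (b i)) := by
    funext A
    rw [ContinuousLinearMap.det, ← LinearMap.det_toMatrix b, Matrix.det_apply']
    simp [LinearMap.toMatrix_apply]
  rw [h]
  fun_prop

theorem hasDerivAt_det_one_add_smul (A : Space d →L[ℝ] Space d) :
    HasDerivAt (fun h : ℝ => (1 + h • A).det)
      (LinearMap.trace ℝ _ (A : Space d →ₗ[ℝ] Space d)) 0 := by
  have b := (EuclideanSpace.basisFun (Fin d) ℝ).toBasis
  have h : (fun h : ℝ => (1 + h • A).det) = fun h => 1 +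
      (LinearMap.toMatrix b b (A : Space d →ₗ[ℝ] Space d)).trace * h +
      (Matrix.det (1 + (Polynomial.X : Polynomial ℝ) • (LinearMap.toMatrix b b
        (A : Space d →ₗ[ℝ] Space d)).map Polynomial.C)).divX.divX.eval h * h ^ 2 := by
    funext h
    rw [← Matrix.det_one_add_smul, ContinuousLinearMap.det, ← LinearMap.det_toMatrix b]
    congr 1
    simp [ContinuousLinearMap.one_def]
  rw [h, LinearMap.trace_eq_matrix_trace ℝ b]
  generalize (LinearMap.toMatrix b b (A : Space d →ₗ[ℝ] Space d)).trace = t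
  generalize Polynomial.divX (R := ℝ) _ = p
  have := (((hasDerivAt_id (0 : ℝ)).const_mul t).const_add 1).add
    ((p.hasDerivAt 0).mul ((hasDerivAt_id (0 : ℝ)).pow 2))
  exact HasDerivAt.congr_deriv this (by simp)

/-- The determinant is C¹, hence Lipschitz on the closed ball of radius M about the identity.
Uniformity in A makes the Jacobian of an Euler step positive for all x at once. -/
theorem abs_det_one_add_smul_sub_one_le (M : ℝ) : ∃ C : ℝ, 0 ≤ C ∧
    ∀ A : Space d →L[ℝ] Space d, ‖A‖ ≤ M → ∀ h : ℝ, |h| ≤ 1 → |(1 + h • A).det - 1| ≤ C * |h| := by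
  obtain ⟨K, hK⟩ := (contDiff_det (d := d)).locallyLipschitz.locallyLipschitzOn
    |>.exists_lipschitzOnWith_of_compact (isCompact_closedBall (1 : Space d →L[ℝ] Space d) M)
  refine ⟨K * |M|, by positivity, fun A hA h hh => ?_⟩
  have hM : 0 ≤ M := (norm_nonneg _).trans hA
  have h1 : (1 + h • A) ∈ Metric.closedBall (1 : Space d →L[ℝ] Space d) M := by
    rw [mem_closedBall_iff_norm, add_sub_cancel_left, norm_smul, Real.norm_eq_abs]
    nlinarith [norm_nonneg A]
  have := hK.dist_le_mul _ h1 1 (Metric.mem_closedBall_self hM)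
  rw [dist_eq_norm, dist_eq_norm, add_sub_cancel_left, norm_smul, Real.norm_eq_abs,
    Real.norm_eq_abs] at this
  have hdet : (1 : Space d →L[ℝ] Space d).det = 1 := by simp [ContinuousLinearMap.det]
  rw [hdet] at this
  refine this.trans ?_
  rw [abs_of_nonneg hM, mul_assoc, mul_comm |h|]
  gcongr

end Det

/-! ### Gaussian mixtures and the continuity equation -/

section Mixture

variable {d : ℕ}

/-- The density at `x` of `b η + s ξ`, where `η ∼ μ` and `ξ ∼ N(0, I_d)` are independent. -/
noncomputable def gaussMix (μ : Measure (Space d)) (s b : ℝ) (x : Space d) : ℝ :=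
  ∫ y, rho s (x - b • y) ∂μ

theorem rho_nonneg (s : ℝ) (x : Space d) : 0 ≤ rho s x := by
  unfold rho
  positivity

theorem gaussMix_nonneg (μ : Measure (Space d)) (s b : ℝ) (x : Space d) : 0 ≤ gaussMix μ s b x :=
  integral_nonneg fun _ => rho_nonneg _ _

theorem continuous_rho (s : ℝ) : Continuous (rho s : Space d → ℝ) := by
  unfold rho
  fun_prop

theorem rho_one (x : Space d) : rho 1 x = rho 1 (0 : Space d) * Real.exp (-(‖x‖ ^ 2 / 2)) := by
  simp [rho]

theorem rho_one_sub_smul (u : ℝ) (x y : Space d) :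
    rho 1 (x - u • y) = rho 1 x * tilt u x y := by
  rw [rho_one, rho_one x, mul_assoc, tilt, ← Real.exp_add, norm_sub_sq_real, norm_smul,
    inner_smul_right, mul_pow, Real.norm_eq_abs, sq_abs]
  congr 2
  ring

theorem gaussMix_one (μ : Measure (Space d)) (u : ℝ) (x : Space d) :
    gaussMix μ 1 u x = rho 1 x * tiltMass μ u x := by
  simp_rw [gaussMix, rho_one_sub_smul, integral_const_mul, tiltMass]

theorem hasDerivAt_rho_line (a b : Space d) (h : ℝ) :
    HasDerivAt (fun h : ℝ => rho 1 (a + h • b))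
      (-(inner ℝ (a + h • b) b) * rho 1 (a + h • b)) h := by
  have h1 : HasDerivAt (fun h : ℝ => a + h • b) b h := by
    simpa using ((hasDerivAt_id h).smul_const b).const_add a
  have h2 := (((h1.norm_sq).div_const 2).neg.exp).const_mul (rho 1 (0 : Space d))
  have h3 : (fun h : ℝ => rho 1 (a + h • b)) =
      fun h : ℝ => rho 1 (0 : Space d) * Real.exp (-(‖a + h • b‖ ^ 2 / 2)) :=
    funext fun h => rho_one _
  rw [h3]
  refine HasDerivAt.congr_deriv h2 ?_
  rw [rho_one (a + h • b)]
  simp only [Pi.neg_apply]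
  ring

/-- A Gaussian envelope for the mixture densities and their derivatives. -/
noncomputable def envelope (C : ℝ) (x : Space d) : ℝ :=
  rho 1 (0 : Space d) * (Real.exp (C ^ 2 / 4) * Real.exp (-(1 / 8) * ‖x‖ ^ 2))

theorem envelope_nonneg (C : ℝ) (x : Space d) : 0 ≤ envelope C x := by
  have := rho_nonneg 1 (0 : Space d)
  unfold envelope
  positivity

theorem integrable_exp_neg_mul_norm_sq {b : ℝ} (hb : 0 < b) :
    Integrable fun x : Space d => Real.exp (-b * ‖x‖ ^ 2) := by
  have := (GaussianFourier.integrable_cexp_neg_mul_sq_norm_add (V := Space d) (b := (b : ℂ))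
    (by simpa using hb) 0 0).norm
  refine this.congr (Eventually.of_forall fun x => ?_)
  simp only [zero_mul, add_zero, Complex.norm_exp]
  congr 1
  norm_cast

theorem integrable_envelope (C : ℝ) : Integrable (envelope C : Space d → ℝ) :=
  ((integrable_exp_neg_mul_norm_sq (by norm_num)).const_mul _).const_mul _

/-- From ‖x‖ ≤ ‖z‖ + C follows ‖x‖²/8 ≤ ‖z‖²/4 + C²/4. The exponent 1/4 instead of 1/2 leaves room
to absorb a factor ‖z‖ from the derivative of the Gaussian. -/
theorem exp_neg_le_envelope {C : ℝ} {x z : Space d} (h : ‖z - x‖ ≤ C) :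
    rho 1 (0 : Space d) * Real.exp (-(‖z‖ ^ 2 / 4)) ≤ envelope C x := by
  unfold envelope
  have := rho_nonneg 1 (0 : Space d)
  gcongr
  rw [← Real.exp_add]
  refine Real.exp_le_exp.2 ?_
  have h1 : ‖x‖ ≤ ‖z‖ + C := by linarith [norm_le_norm_add_norm_sub z x]
  nlinarith [norm_nonneg x, norm_nonneg z, sq_nonneg (‖z‖ - C)]

theorem rho_le_envelope {C : ℝ} {x z : Space d} (h : ‖z - x‖ ≤ C) :
    rho 1 z ≤ envelope C x := by
  refine le_trans ?_ (exp_neg_le_envelope h)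
  rw [rho_one]
  have := rho_nonneg 1 (0 : Space d)
  gcongr
  nlinarith [sq_nonneg ‖z‖]

theorem norm_mul_rho_le_envelope {C : ℝ} {x z : Space d} (h : ‖z - x‖ ≤ C) :
    ‖z‖ * rho 1 z ≤ envelope C x := by
  refine le_trans ?_ (exp_neg_le_envelope h)
  rw [rho_one, mul_left_comm]
  have := rho_nonneg 1 (0 : Space d)
  gcongr
  have h1 : ‖z‖ ≤ Real.exp (‖z‖ ^ 2 / 4) := by
    nlinarith [Real.add_one_le_exp (‖z‖ ^ 2 / 4), sq_nonneg (‖z‖ - 2)]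
  calc ‖z‖ * Real.exp (-(‖z‖ ^ 2 / 2))
      ≤ Real.exp (‖z‖ ^ 2 / 4) * Real.exp (-(‖z‖ ^ 2 / 2)) := by gcongr
    _ = _ := by
        rw [← Real.exp_add]
        congr 1
        ring

variable {μ : Measure (Space d)} [IsProbabilityMeasure μ] {R : ℝ}

theorem continuous_gaussMix_one (hR : ∀ᵐ y ∂μ, ‖y‖ ≤ R) (u : ℝ) :
    Continuous (gaussMix μ 1 u) := by
  have : gaussMix μ 1 u = fun x => rho 1 x * tiltMass μ u x := funext fun x => gaussMix_one μ u x
  rw [this]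
  exact (continuous_rho 1).mul
    ((continuous_tiltMass hR).comp (by fun_prop : Continuous fun x => (u, x)))

theorem gaussMix_one_le_envelope (hR : ∀ᵐ y ∂μ, ‖y‖ ≤ R) (u : ℝ) (x : Space d) :
    gaussMix μ 1 u x ≤ envelope (|u| * R) x := by
  have h : gaussMix μ 1 u x ≤ ∫ _, envelope (|u| * R) x ∂μ := by
    refine integral_mono_ae (integrable_of_continuous hR
      ((continuous_rho 1).comp (by fun_prop))) (integrable_const _) ?_
    filter_upwards [hR] with y hy
    refine rho_le_envelope ?_
    rw [sub_sub_cancel_left, norm_neg, norm_smul, Real.norm_eq_abs]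
    gcongr
  simpa using h

theorem integrable_gaussMix_one (hR : ∀ᵐ y ∂μ, ‖y‖ ≤ R) (u : ℝ) :
    Integrable (gaussMix μ 1 u) := by
  refine (integrable_envelope (|u| * R)).mono' (continuous_gaussMix_one hR u).aestronglyMeasurable
    (Eventually.of_forall fun x => ?_)
  rw [Real.norm_of_nonneg (gaussMix_nonneg _ _ _ _)]
  exact gaussMix_one_le_envelope hR u x

/-- The derivative of the mixture density along the line `h ↦ (s + h, x + h v)`. -/
noncomputable def gaussMixLineDeriv (μ : Measure (Space d)) (s : ℝ) (x v : Space d) (h : ℝ) : ℝ :=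
  ∫ y, -(inner ℝ (x - s • y + h • (v - y)) (v - y)) * rho 1 (x - s • y + h • (v - y)) ∂μ

theorem abs_gaussMixLineDeriv_integrand_le {s h : ℝ} {x v y : Space d} (hv : ‖v‖ ≤ R)
    (hy : ‖y‖ ≤ R) (hh : |h| ≤ 1) :
    ‖-(inner ℝ (x - s • y + h • (v - y)) (v - y)) * rho 1 (x - s • y + h • (v - y))‖ ≤
      2 * R * envelope ((|s| + 2) * R) x := by
  have hvy : ‖v - y‖ ≤ 2 * R := (norm_sub_le _ _).trans (by linarith)
  -- The shift is at most |s|R from s • y plus 2R from h • (v - y).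
  have hz : ‖x - s • y + h • (v - y) - x‖ ≤ (|s| + 2) * R := by
    have : x - s • y + h • (v - y) - x = h • (v - y) - s • y := by abel
    rw [this]
    refine (norm_sub_le _ _).trans ?_
    rw [norm_smul, norm_smul, Real.norm_eq_abs, Real.norm_eq_abs]
    have h1 : |h| * ‖v - y‖ ≤ 1 * (2 * R) := by gcongr
    have h2 : |s| * ‖y‖ ≤ |s| * R := by gcongr
    linarith
  rw [norm_mul, norm_neg, Real.norm_of_nonneg (rho_nonneg _ _)]
  have hR0 : 0 ≤ R := (norm_nonneg _).trans hy
  have := rho_nonneg 1 (x - s • y + h • (v - y))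
  calc _ ≤ (‖x - s • y + h • (v - y)‖ * ‖v - y‖) * rho 1 (x - s • y + h • (v - y)) := by
        gcongr
        exact norm_inner_le_norm _ _
    _ = ‖v - y‖ * (‖x - s • y + h • (v - y)‖ * rho 1 (x - s • y + h • (v - y))) := by ring
    _ ≤ _ := mul_le_mul hvy (norm_mul_rho_le_envelope hz) (by positivity) (by positivity)

theorem hasDerivAt_gaussMix_line (hR : ∀ᵐ y ∂μ, ‖y‖ ≤ R) (s : ℝ) (x : Space d) {v : Space d}
    (hv : ‖v‖ ≤ R) {h : ℝ} (hh : |h| < 1) :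
    HasDerivAt (fun h : ℝ => gaussMix μ 1 (s + h) (x + h • v)) (gaussMixLineDeriv μ s x v h) h := by
  have hfun : (fun h : ℝ => gaussMix μ 1 (s + h) (x + h • v)) =
      fun h => ∫ y, rho 1 (x - s • y + h • (v - y)) ∂μ := by
    funext h
    refine integral_congr_ae (Eventually.of_forall fun y => ?_)
    simp only
    congr 1
    module
  rw [hfun]
  have hcont : ∀ h : ℝ, Continuous fun y => rho 1 (x - s • y + h • (v - y)) := fun h =>
    (continuous_rho 1).comp (by fun_prop)
  refine (hasDerivAt_integral_of_dominated_loc_of_deriv_le (μ := μ) (𝕜 := ℝ)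
    (F := fun h y => rho 1 (x - s • y + h • (v - y)))
    (F' := fun h y => -(inner ℝ (x - s • y + h • (v - y)) (v - y)) *
      rho 1 (x - s • y + h • (v - y)))
    (bound := fun _ => 2 * R * envelope ((|s| + 2) * R) x) (s := Metric.ball 0 1)
    (Metric.isOpen_ball.mem_nhds (by simpa using hh))
    (Eventually.of_forall fun z => (hcont z).aestronglyMeasurable)
    (integrable_of_continuous hR (hcont h))
    (Continuous.aestronglyMeasurable ((by fun_prop : Continuous fun y =>
      -(inner ℝ (x - s • y + h • (v - y)) (v - y))).mul (hcont h))) ?_ (integrable_const _) ?_).2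
  · filter_upwards [hR] with y hy z hz
    exact abs_gaussMixLineDeriv_integrand_le hv hy (by simpa using (Metric.mem_ball.1 hz).le)
  · exact Eventually.of_forall fun y z _ => hasDerivAt_rho_line _ _ _

theorem abs_gaussMixLineDeriv_le (hR : ∀ᵐ y ∂μ, ‖y‖ ≤ R) (s : ℝ) (x : Space d) {v : Space d}
    (hv : ‖v‖ ≤ R) {h : ℝ} (hh : |h| ≤ 1) :
    |gaussMixLineDeriv μ s x v h| ≤ 2 * R * envelope ((|s| + 2) * R) x := by
  have := norm_integral_le_of_norm_le_const (μ := μ) (f := fun y =>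
    -(inner ℝ (x - s • y + h • (v - y)) (v - y)) * rho 1 (x - s • y + h • (v - y)))
    (hR.mono fun y hy => abs_gaussMixLineDeriv_integrand_le (s := s) (x := x) hv hy hh)
  simpa [gaussMixLineDeriv] using this

theorem abs_gaussMix_line_sub_le (hR : ∀ᵐ y ∂μ, ‖y‖ ≤ R) (s : ℝ) (x : Space d) {v : Space d}
    (hv : ‖v‖ ≤ R) {h : ℝ} (hh : |h| < 1) :
    |gaussMix μ 1 (s + h) (x + h • v) - gaussMix μ 1 s x| ≤
      2 * R * envelope ((|s| + 2) * R) x * |h| := by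
  have := (convex_ball (0 : ℝ) 1).norm_image_sub_le_of_norm_hasDerivWithin_le (𝕜 := ℝ)
    (f := fun h : ℝ => gaussMix μ 1 (s + h) (x + h • v)) (x := 0) (y := h)
    (fun z hz => (hasDerivAt_gaussMix_line hR s x hv (by simpa using hz)).hasDerivWithinAt)
    (fun z hz => abs_gaussMixLineDeriv_le hR s x hv (by simpa using (Metric.mem_ball.1 hz).le))
    (by simp) (by simpa using hh)
  simpa using this

/-- This is the continuity equation along the characteristic direction: ∂_s g + m·∇g = -g div m.
With v the tilted mean, the terms in ⟨x, v⟩ cancel and s(Z‖v‖² - ∫ ‖y‖²) remains, Z being the mass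
and the integral being against the tilt: minus Z times the divergence. -/
theorem gaussMixLineDeriv_zero (hR : ∀ᵐ y ∂μ, ‖y‖ ≤ R) (s : ℝ) (x : Space d) :
    gaussMixLineDeriv μ s x (tiltMean μ s x) 0 =
      -(gaussMix μ 1 s x * LinearMap.trace ℝ _ (tiltMeanDeriv μ s x : Space d →ₗ[ℝ] Space d)) := by
  rw [gaussMix_one, mul_assoc, trace_tiltMeanDeriv hR]
  set v := tiltMean μ s x with hv
  have hc : Continuous fun y : Space d => y := continuous_id
  have key : ∀ y : Space d, -(inner ℝ (x - s • y + (0 : ℝ) • (v - y)) (v - y)) *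
      rho 1 (x - s • y + (0 : ℝ) • (v - y)) =
      rho 1 x * (-(inner ℝ x v) * tilt s x y + inner ℝ (x + s • v) (tilt s x y • y) -
        s * (tilt s x y • ‖y‖ ^ 2)) := by
    intro y
    rw [zero_smul, add_zero, rho_one_sub_smul]
    simp only [inner_sub_left, inner_sub_right, inner_add_left, inner_smul_left, inner_smul_right,
      real_inner_self_eq_norm_sq, smul_eq_mul, real_inner_comm v y]
    simp
    ring
  have i1 := (integrable_tilt hR s x).const_mul (-(inner ℝ x v))
  have i2 := (integrable_tilt_smul hR hc s x).const_inner (𝕜 := ℝ) (x + s • v)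
  have i3 := (integrable_tilt_smul hR (c := fun y => ‖y‖ ^ 2) (by fun_prop) s x).const_mul s
  have i12 : Integrable (fun y => -(inner ℝ x v) * tilt s x y +
    inner ℝ (x + s • v) (tilt s x y • y)) μ := i1.add i2
  simp_rw [gaussMixLineDeriv, key]
  rw [integral_const_mul, integral_sub i12 i3, integral_add i1 i2, integral_const_mul,
    integral_const_mul, integral_inner (integrable_tilt_smul hR hc s x)]
  have h1 : ∫ y, tilt s x y ∂μ = tiltMass μ s x := rfl
  have h2 : ∫ y, tilt s x y • y ∂μ = tiltMass μ s x • v := tiltInt_id hR s x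
  have h3 : ∫ y, tilt s x y • ‖y‖ ^ 2 ∂μ = tiltInt μ (fun y => ‖y‖ ^ 2) s x := rfl
  rw [h1, h2, h3, inner_smul_right, inner_add_left, inner_smul_left, real_inner_self_eq_norm_sq]
  simp
  ring

end Mixture
-- Transport of the mixture density by the flow
section Transport

/-- Solving x + f x = y means finding the fixed point of the contraction x ↦ y - f x. -/
theorem bijective_add_of_lipschitzWith {E : Type*} [NormedAddCommGroup E] [CompleteSpace E]
    {f : E → E} {K : NNReal} (hK : K < 1) (hf : LipschitzWith K f) :
    Function.Bijective fun x => x + f x := by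
  constructor
  · intro x y hxy
    have h1 : x - y = f y - f x := by
      have : x + f x = y + f y := hxy
      rw [sub_eq_sub_iff_add_eq_add, this, add_comm]
    have h2 := hf.dist_le_mul x y
    rw [dist_comm (f x), dist_eq_norm, dist_eq_norm, ← h1] at h2
    have h3 : (K : ℝ) < 1 := hK
    have h4 : ‖x - y‖ = 0 := by nlinarith [norm_nonneg (x - y)]
    exact sub_eq_zero.1 (norm_eq_zero.1 h4)
  · intro y
    have hc : ContractingWith K fun x => y - f x :=
      ⟨hK, LipschitzWith.of_dist_le_mul fun a b => by
        rw [dist_sub_left]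
        exact hf.dist_le_mul a b⟩
    have : Nonempty E := ⟨0⟩
    refine ⟨ContractingWith.fixedPoint _ hc, ?_⟩
    have := hc.fixedPoint_isFixedPt
    rw [Function.IsFixedPt] at this
    exact eq_sub_iff_add_eq.1 this.symm

variable {d : ℕ} {μ : Measure (Space d)} [IsProbabilityMeasure μ] {R : ℝ}

theorem exists_tiltMean_flow (hR : ∀ᵐ y ∂μ, ‖y‖ ≤ R) :
    ∃ Φ : ℝ → Space d → ℝ → Space d,
      ∀ s x, Φ s x s = x ∧ IsIntegralCurve (Φ s x) (tiltMean μ) := by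
  choose Φ h using fun s x => exists_integralCurve (locLipschitzField_tiltMean hR)
    (fun x => (continuous_tiltMean hR).comp (by fun_prop : Continuous fun t => (t, x)))
    (norm_tiltMean_le hR) s x
  exact ⟨Φ, h⟩

variable {Φ : ℝ → Space d → ℝ → Space d}

theorem norm_flow_sub_le (hR : ∀ᵐ y ∂μ, ‖y‖ ≤ R)
    (hΦ : ∀ s x, Φ s x s = x ∧ IsIntegralCurve (Φ s x) (tiltMean μ)) (s h : ℝ) (x : Space d) :
    ‖Φ s x (s + h) - x‖ ≤ R * |h| := by
  have := convex_univ.norm_image_sub_le_of_norm_hasDerivWithin_le (𝕜 := ℝ) (f := Φ s x)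
    (x := s) (y := s + h) (fun z _ => ((hΦ s x).2 z).hasDerivWithinAt)
    (fun z _ => norm_tiltMean_le hR _ _) (mem_univ _) (mem_univ _)
  simpa [(hΦ s x).1] using this

theorem flow_flow (hR : ∀ᵐ y ∂μ, ‖y‖ ≤ R)
    (hΦ : ∀ s x, Φ s x s = x ∧ IsIntegralCurve (Φ s x) (tiltMean μ)) (s t : ℝ) (x : Space d) :
    Φ t (Φ s x t) = Φ s x :=
  integralCurve_unique (locLipschitzField_tiltMean hR) (hΦ _ _).2 (hΦ _ _).2 (hΦ t _).1

/-- One constant serves all initial times in a bounded range, since the Euler step moves the initial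
time to s + h. -/
theorem exists_lipschitzWith_flow (hR : ∀ᵐ y ∂μ, ‖y‖ ≤ R)
    (hΦ : ∀ s x, Φ s x s = x ∧ IsIntegralCurve (Φ s x) (tiltMean μ)) (N U : ℝ) :
    ∃ L : NNReal, ∀ s, |s| ≤ N → LipschitzWith L fun x => Φ s x U := by
  obtain ⟨K, hK⟩ := locLipschitzField_tiltMean hR (max N |U|)
  refine ⟨(Real.exp (K * (|U| + N))).toNNReal, fun s hs => LipschitzWith.of_dist_le_mul
    fun x y => ?_⟩
  have := dist_integralCurve_le hK (hΦ s x).2 (hΦ s y).2 (hs.trans (le_max_left _ _))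
    (le_max_right _ _)
  rw [(hΦ s x).1, (hΦ s y).1] at this
  rw [Real.coe_toNNReal _ (Real.exp_pos _).le, mul_comm]
  refine this.trans ?_
  gcongr
  exact (abs_sub _ _).trans (by gcongr)

theorem continuous_flow (hR : ∀ᵐ y ∂μ, ‖y‖ ≤ R)
    (hΦ : ∀ s x, Φ s x s = x ∧ IsIntegralCurve (Φ s x) (tiltMean μ)) (s U : ℝ) :
    Continuous fun x => Φ s x U := by
  obtain ⟨L, hL⟩ := exists_lipschitzWith_flow hR hΦ |s| U
  exact (hL s le_rfl).continuous

/-- The density transported along one explicit Euler step, including the Jacobian. -/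
noncomputable def stepDensity (μ : Measure (Space d)) (s : ℝ) (x : Space d) (h : ℝ) : ℝ :=
  gaussMix μ 1 (s + h) (x + h • tiltMean μ s x) * (1 + h • tiltMeanDeriv μ s x).det

omit [IsProbabilityMeasure μ] in
theorem stepDensity_zero (s : ℝ) (x : Space d) : stepDensity μ s x 0 = gaussMix μ 1 s x := by
  simp [stepDensity, ContinuousLinearMap.det]

/-- By the product rule, the derivative of the density along the step is -g div m and that of the
Jacobian contributes +g div m. -/
theorem hasDerivAt_stepDensity_zero (hR : ∀ᵐ y ∂μ, ‖y‖ ≤ R) (s : ℝ) (x : Space d) :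
    HasDerivAt (stepDensity μ s x) 0 0 := by
  have h1 := hasDerivAt_gaussMix_line hR s x (norm_tiltMean_le hR s x) (h := 0) (by simp)
  have h2 := h1.mul (hasDerivAt_det_one_add_smul (tiltMeanDeriv μ s x))
  refine HasDerivAt.congr_deriv h2 ?_
  rw [gaussMixLineDeriv_zero hR]
  simp [ContinuousLinearMap.det]

theorem exists_abs_stepDensity_sub_le (hR : ∀ᵐ y ∂μ, ‖y‖ ≤ R) (s : ℝ) :
    ∃ C : ℝ, ∀ x h, |h| < 1 → |stepDensity μ s x h - gaussMix μ 1 s x| ≤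
      C * (envelope ((|s| + 2) * R) x + gaussMix μ 1 s x) * |h| := by
  have hR0 : 0 ≤ R := (norm_nonneg _).trans (norm_tiltMean_le hR 0 0)
  obtain ⟨C, hC0, hC⟩ := abs_det_one_add_smul_sub_one_le (d := d) (2 * (|s| * R ^ 2))
  refine ⟨2 * R * (1 + C) + C, fun x h hh => ?_⟩
  have h1 := abs_gaussMix_line_sub_le hR s x (norm_tiltMean_le hR s x) hh
  have h2 := hC _ (norm_tiltMeanDeriv_le hR s x) h hh.le
  have h3 := gaussMix_nonneg μ 1 s x
  have h4 := envelope_nonneg ((|s| + 2) * R) x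
  rw [stepDensity]
  set D := (1 + h • tiltMeanDeriv μ s x).det
  set k := gaussMix μ 1 (s + h) (x + h • tiltMean μ s x)
  have hD : |D| ≤ 1 + C := by
    have := abs_sub_abs_le_abs_sub D 1
    rw [abs_one] at this
    nlinarith [abs_nonneg h]
  have : k * D - gaussMix μ 1 s x =
      (k - gaussMix μ 1 s x) * D + gaussMix μ 1 s x * (D - 1) := by ring
  rw [this]
  refine (abs_add_le _ _).trans ?_
  rw [abs_mul, abs_mul, abs_of_nonneg h3]
  have h5 := mul_le_mul h1 hD (abs_nonneg _) (by positivity)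
  have h6 := mul_le_mul_of_nonneg_left h2 h3
  have h7 : 0 ≤ C * envelope ((|s| + 2) * R) x * |h| := by positivity
  have h8 : 0 ≤ 2 * R * (1 + C) * gaussMix μ 1 s x * |h| := by positivity
  linarith

theorem integral_gaussMix_smul_eq_integral_stepDensity (hR : ∀ᵐ y ∂μ, ‖y‖ ≤ R) (s : ℝ) :
    ∀ᶠ h in 𝓝 (0 : ℝ), ∀ e : Space d → ℂ, ∫ x, gaussMix μ 1 (s + h) x • e x =
      ∫ x, stepDensity μ s x h • e (x + h • tiltMean μ s x) := by
  obtain ⟨C, hC0, hC⟩ := abs_det_one_add_smul_sub_one_le (d := d) (2 * (|s| * R ^ 2))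
  have e1 : ∀ᶠ h in 𝓝 (0 : ℝ), |h| < 1 :=
    continuous_abs.continuousAt.eventually_lt continuousAt_const (by simp)
  have e2 : ∀ᶠ h in 𝓝 (0 : ℝ), C * |h| < 1 :=
    (by fun_prop : Continuous fun h : ℝ => C * |h|).continuousAt.eventually_lt
      continuousAt_const (by simp)
  have e3 : ∀ᶠ h in 𝓝 (0 : ℝ), ‖h‖₊ * (2 * (|s| * R ^ 2)).toNNReal < 1 :=
    (by fun_prop : Continuous fun h : ℝ => ‖h‖₊ * (2 * (|s| * R ^ 2)).toNNReal).continuousAt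
      |>.eventually_lt continuousAt_const (by simp)
  filter_upwards [e1, e2, e3] with h h1 h2 h3 e
  have hbij : Function.Bijective fun x => x + h • tiltMean μ s x :=
    bijective_add_of_lipschitzWith h3 ((lipschitzWith_smul h).comp (lipschitzWith_tiltMean hR s))
  have hder : ∀ x ∈ univ, HasFDerivWithinAt (fun x => x + h • tiltMean μ s x)
      (1 + h • tiltMeanDeriv μ s x) univ x := fun x _ =>
    ((hasFDerivAt_id x).add ((hasFDerivAt_tiltMean hR s x).const_smul h)).hasFDerivWithinAt
  have := integral_image_eq_integral_abs_det_fderiv_smul volume MeasurableSet.univ hder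
    hbij.injective.injOn fun x => gaussMix μ 1 (s + h) x • e x
  rw [image_univ, hbij.surjective.range_eq, setIntegral_univ, setIntegral_univ] at this
  rw [this]
  refine integral_congr_ae (Eventually.of_forall fun x => ?_)
  -- The determinant differs from 1 by less than 1, so the absolute value in the change of variables
  -- can be dropped.
  have hpos : 0 ≤ (1 + h • tiltMeanDeriv μ s x).det := by
    have := abs_le.1 ((hC _ (norm_tiltMeanDeriv_le hR s x) h h1.le).trans h2.le)
    linarith
  simp only [stepDensity, smul_smul, abs_of_nonneg hpos]
  rw [mul_comm]

theorem measurable_det_tiltMeanDeriv (hR : ∀ᵐ y ∂μ, ‖y‖ ≤ R) (s h : ℝ) :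
    Measurable fun x => (1 + h • tiltMeanDeriv μ s x).det := by
  have h1 : tiltMeanDeriv μ s = fderiv ℝ (tiltMean μ s) :=
    funext fun x => (hasFDerivAt_tiltMean hR s x).fderiv.symm
  have h2 : Measurable (tiltMeanDeriv μ s) := h1 ▸ measurable_fderiv ℝ _
  exact ContinuousLinearMap.continuous_det.measurable.comp
    ((by fun_prop : Continuous fun A : Space d →L[ℝ] Space d => 1 + h • A).measurable.comp h2)

/-- After the Euler change of variables both factors of the integrand are stationary at h = 0, so
dominated differentiation gives zero. -/
theorem hasDerivAt_integral_gaussMix_smul_flow (hR : ∀ᵐ y ∂μ, ‖y‖ ≤ R)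
    (hΦ : ∀ s x, Φ s x s = x ∧ IsIntegralCurve (Φ s x) (tiltMean μ)) {e : Space d → ℂ}
    {L : NNReal} (he : LipschitzWith L e) (he1 : ∀ x, ‖e x‖ ≤ 1) (U s : ℝ) :
    HasDerivAt (fun s => ∫ x, gaussMix μ 1 s x • e (Φ s x U)) 0 s := by
  have hR0 : 0 ≤ R := (norm_nonneg _).trans (norm_tiltMean_le hR 0 0)
  obtain ⟨L₁, hL₁⟩ := exists_lipschitzWith_flow hR hΦ (|s| + 1) U
  obtain ⟨C, hC⟩ := exists_abs_stepDensity_sub_le hR s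
  -- By the flow property, Φ s x U equals the flow from time s + h started at Φ s x (s + h); two
  -- initial points at one time are compared.
  have hG : ∀ x h, |h| < 1 → ‖e (Φ (s + h) (x + h • tiltMean μ s x) U) - e (Φ s x U)‖ ≤
      (L * L₁ : NNReal) * ‖x + h • tiltMean μ s x - Φ s x (s + h)‖ := by
    intro x h hh
    have := (he.comp (hL₁ (s + h) ((abs_add_le _ _).trans (by gcongr)))).dist_le_mul
      (x + h • tiltMean μ s x) (Φ s x (s + h))
    simpa only [Function.comp_apply, flow_flow hR hΦ, dist_eq_norm] using this
  have hstep : ∀ x h, ‖x + h • tiltMean μ s x - Φ s x (s + h)‖ ≤ 2 * R * |h| := by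
    intro x h
    have h1 := norm_flow_sub_le hR hΦ s h x
    have h2 : ‖h • tiltMean μ s x‖ ≤ R * |h| := by
      rw [norm_smul, Real.norm_eq_abs, mul_comm]
      gcongr
      exact norm_tiltMean_le hR s x
    calc _ = ‖h • tiltMean μ s x - (Φ s x (s + h) - x)‖ := by congr 1; abel
      _ ≤ _ := (norm_sub_le _ _).trans (by linarith)
  have hGderiv : ∀ x, HasDerivAt (fun h => e (Φ (s + h) (x + h • tiltMean μ s x) U)) 0 0 := by
    intro x
    have h1 : HasDerivAt (fun h => x + h • tiltMean μ s x - Φ s x (s + h)) 0 0 := by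
      have h2 : HasDerivAt (fun h => Φ s x (s + h)) (tiltMean μ s x) 0 := by
        have := (hΦ s x).2 (s + 0)
        rw [add_zero, (hΦ s x).1] at this
        exact HasDerivAt.comp_const_add s 0 (by rwa [add_zero])
      have h3 := (((hasDerivAt_id (0 : ℝ)).smul_const (tiltMean μ s x)).const_add x).sub h2
      exact HasDerivAt.congr_deriv h3 (by simp)
    rw [hasDerivAt_iff_isLittleO] at h1 ⊢
    refine Asymptotics.IsBigO.trans_isLittleO ?_ h1
    refine Asymptotics.IsBigO.of_bound (L * L₁ : NNReal) ?_
    have e1 : ∀ᶠ h in 𝓝 (0 : ℝ), |h| < 1 :=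
      continuous_abs.continuousAt.eventually_lt continuousAt_const (by simp)
    filter_upwards [e1] with h hh
    simpa [(hΦ s x).1] using hG x h hh
  have key := hasFDerivAt_integral_of_dominated_loc_of_lip' (𝕜 := ℝ)
    (μ := (volume : Measure (Space d)))
    (F := fun h x => stepDensity μ s x h • e (Φ (s + h) (x + h • tiltMean μ s x) U))
    (F' := fun _ => 0) (x₀ := 0) (s := Metric.ball 0 1)
    (bound := fun x => C * (envelope ((|s| + 2) * R) x + gaussMix μ 1 s x) +
      gaussMix μ 1 s x * ((L * L₁ : NNReal) * (2 * R)))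
    (Metric.ball_mem_nhds _ one_pos) ?_ ?_ aestronglyMeasurable_const ?_ ?_ ?_
  · have h1 := key.2.hasDerivAt
    simp only [integral_zero, _root_.zero_apply] at h1
    have h2 : HasDerivAt (fun h => ∫ x, gaussMix μ 1 (s + h) x • e (Φ (s + h) x U)) 0 0 := by
      refine h1.congr_of_eventuallyEq ?_
      filter_upwards [integral_gaussMix_smul_eq_integral_stepDensity hR s] with h hh
      exact hh fun x => e (Φ (s + h) x U)
    have h3 := HasDerivAt.comp_sub_const s s (by rwa [sub_self])
      (f := fun h => ∫ x, gaussMix μ 1 (s + h) x • e (Φ (s + h) x U))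
    simpa using h3
  · intro h _
    have hT : Continuous fun x => x + h • tiltMean μ s x :=
      continuous_id.add ((continuous_tiltMean hR).comp
        (by fun_prop : Continuous fun x => (s, x)) |>.const_smul h)
    have hs : AEStronglyMeasurable (fun x => stepDensity μ s x h) :=
      ((continuous_gaussMix_one hR _).comp hT).aestronglyMeasurable.mul
        (measurable_det_tiltMeanDeriv hR s h).aestronglyMeasurable
    exact hs.smul
      (he.continuous.comp ((continuous_flow hR hΦ (s + h) U).comp hT)).aestronglyMeasurable
  · simp only [stepDensity_zero, add_zero, zero_smul]
    refine (integrable_gaussMix_one hR s).mono' ((continuous_gaussMix_one hR s).smul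
      (he.continuous.comp (continuous_flow hR hΦ s U))).aestronglyMeasurable
      (Eventually.of_forall fun x => ?_)
    rw [norm_smul, Real.norm_of_nonneg (gaussMix_nonneg _ _ _ _)]
    exact mul_le_of_le_one_right (gaussMix_nonneg _ _ _ _) (he1 _)
  · refine Eventually.of_forall fun x h hh => ?_
    have hh' : |h| < 1 := by simpa using hh
    simp only [stepDensity_zero, add_zero, zero_smul, sub_zero]
    have : stepDensity μ s x h • e (Φ (s + h) (x + h • tiltMean μ s x) U) -
        gaussMix μ 1 s x • e (Φ s x U) =
        (stepDensity μ s x h - gaussMix μ 1 s x) • e (Φ (s + h) (x + h • tiltMean μ s x) U) +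
        gaussMix μ 1 s x • (e (Φ (s + h) (x + h • tiltMean μ s x) U) - e (Φ s x U)) := by
      rw [sub_smul, smul_sub]
      abel
    rw [this]
    refine (norm_add_le _ _).trans ?_
    rw [norm_smul, norm_smul, Real.norm_of_nonneg (gaussMix_nonneg _ _ _ _), Real.norm_eq_abs,
      Real.norm_eq_abs, add_mul]
    refine add_le_add ((mul_le_of_le_one_right (abs_nonneg _) (he1 _)).trans (hC x h hh')) ?_
    rw [mul_assoc (gaussMix μ 1 s x), mul_assoc _ (2 * R)]
    refine mul_le_mul_of_nonneg_left ((hG x h hh').trans ?_) (gaussMix_nonneg _ _ _ _)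
    exact mul_le_mul_of_nonneg_left (hstep x h) (NNReal.coe_nonneg _)
  · exact (((integrable_envelope _).add (integrable_gaussMix_one hR s)).const_mul C).add
      ((integrable_gaussMix_one hR s).mul_const _)
  · refine Eventually.of_forall fun x => ?_
    have := (hasDerivAt_stepDensity_zero hR s x).smul (hGderiv x)
    rw [smul_zero, zero_smul, add_zero] at this
    exact (HasDerivAt.hasFDerivAt this).congr_fderiv (by simp)

theorem integral_gaussMix_smul_flow (hR : ∀ᵐ y ∂μ, ‖y‖ ≤ R)
    (hΦ : ∀ s x, Φ s x s = x ∧ IsIntegralCurve (Φ s x) (tiltMean μ)) {e : Space d → ℂ}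
    {L : NNReal} (he : LipschitzWith L e) (he1 : ∀ x, ‖e x‖ ≤ 1) (s U : ℝ) :
    ∫ x, gaussMix μ 1 s x • e (Φ s x U) = ∫ x, gaussMix μ 1 U x • e x := by
  have hd := hasDerivAt_integral_gaussMix_smul_flow hR hΦ he he1 U
  have := is_const_of_deriv_eq_zero (fun s => (hd s).differentiableAt) (fun s => (hd s).deriv) s U
  simpa only [(hΦ U _).1] using this

end Transport
-- Identification of laws by characteristic functions
section CharFun

variable {d : ℕ}

theorem rho_smul_cexp_eq {s : ℝ} (k x : Space d) :
    rho s x • Complex.exp (inner ℝ x k * Complex.I) =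
      (((2 * Real.pi * s ^ 2) ^ (-(d : ℝ) / 2) : ℝ) : ℂ) *
        Complex.exp (-(1 / (2 * s ^ 2) : ℝ) * ‖x‖ ^ 2 + Complex.I * inner ℝ k x) := by
  rw [rho, Complex.real_smul, Complex.ofReal_mul, mul_assoc, Complex.ofReal_exp, ← Complex.exp_add,
    real_inner_comm]
  congr 2
  push_cast
  ring

theorem integrable_rho_smul_cexp {s : ℝ} (hs : 0 < s) (k : Space d) :
    Integrable fun x => rho s x • Complex.exp (inner ℝ x k * Complex.I) := by
  simp_rw [rho_smul_cexp_eq]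
  exact (GaussianFourier.integrable_cexp_neg_mul_sq_norm_add (V := Space d)
    (b := ((1 / (2 * s ^ 2) : ℝ) : ℂ)) (by rw [Complex.ofReal_re]; positivity) _ _).const_mul _

theorem integral_rho_smul_cexp {s : ℝ} (hs : 0 < s) (k : Space d) :
    ∫ x, rho s x • Complex.exp (inner ℝ x k * Complex.I) =
      Complex.exp (-(s ^ 2 * ‖k‖ ^ 2 / 2 : ℝ)) := by
  simp_rw [rho_smul_cexp_eq]
  rw [integral_const_mul, GaussianFourier.integral_cexp_neg_mul_sq_norm_add (V := Space d)
    (b := ((1 / (2 * s ^ 2) : ℝ) : ℂ)) (by rw [Complex.ofReal_re]; positivity), ← mul_assoc]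
  have h0 : 0 < 2 * Real.pi * s ^ 2 := by positivity
  have h1 : ((Real.pi : ℂ) / ((1 / (2 * s ^ 2) : ℝ) : ℂ)) ^ (Module.finrank ℝ (Space d) / 2 : ℂ) =
      (((2 * Real.pi * s ^ 2) ^ ((d : ℝ) / 2) : ℝ) : ℂ) := by
    rw [Complex.ofReal_cpow h0.le, finrank_euclideanSpace_fin]
    congr 1
    · push_cast
      field_simp
    · push_cast
      rfl
  rw [h1, ← Complex.ofReal_mul, ← Real.rpow_add h0]
  have hs' : (s : ℂ) ≠ 0 := by exact_mod_cast hs.ne'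
  simp only [neg_div, neg_add_cancel, Real.rpow_zero, Complex.ofReal_one, one_mul, Complex.I_sq]
  congr 1
  push_cast
  field_simp
  ring

theorem integrable_rho {s : ℝ} (hs : 0 < s) : Integrable (rho s : Space d → ℝ) := by
  refine (integrable_rho_smul_cexp hs (0 : Space d)).norm.congr (Eventually.of_forall fun x => ?_)
  simp [abs_of_nonneg (rho_nonneg s x)]

theorem integral_rho_sub_smul_cexp {s : ℝ} (hs : 0 < s) (k m : Space d) :
    ∫ x, rho s (x - m) • Complex.exp (inner ℝ x k * Complex.I) =
      Complex.exp (inner ℝ m k * Complex.I) * Complex.exp (-(s ^ 2 * ‖k‖ ^ 2 / 2 : ℝ)) := by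
  rw [← integral_rho_smul_cexp hs, ← integral_const_mul,
    ← integral_add_right_eq_self _ m]
  refine integral_congr_ae (Eventually.of_forall fun x => ?_)
  simp only [add_sub_cancel_right, inner_add_left, Complex.ofReal_add, add_mul, Complex.exp_add,
    Complex.real_smul]
  ring

variable (μ : Measure (Space d)) [IsProbabilityMeasure μ]

theorem integrable_prod_rho {s : ℝ} (hs : 0 < s) (b : ℝ) :
    Integrable (fun p : Space d × Space d => rho s (p.1 - b • p.2)) (volume.prod μ) := by
  have hc : Continuous fun p : Space d × Space d => rho s (p.1 - b • p.2) :=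
    (continuous_rho s).comp (by fun_prop)
  rw [integrable_prod_iff' hc.aestronglyMeasurable]
  refine ⟨Eventually.of_forall fun y => (integrable_rho hs).comp_sub_right (b • y), ?_⟩
  have : ∀ y : Space d, ∫ x : Space d, ‖rho s (x - b • y)‖ = ∫ x : Space d, ‖rho s x‖ := fun y =>
    integral_sub_right_eq_self (fun x : Space d => ‖rho s x‖) (b • y)
  simp only [this]
  exact integrable_const _

theorem integrable_gaussMix {s : ℝ} (hs : 0 < s) (b : ℝ) : Integrable (gaussMix μ s b) :=
  (integrable_prod_rho μ hs b).integral_prod_left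

theorem integral_gaussMix_smul_cexp {s : ℝ} (hs : 0 < s) (b : ℝ) (k : Space d) :
    ∫ x, gaussMix μ s b x • Complex.exp (inner ℝ x k * Complex.I) =
      charFun μ (b • k) * Complex.exp (-(s ^ 2 * ‖k‖ ^ 2 / 2 : ℝ)) := by
  have hint : Integrable (fun p : Space d × Space d => rho s (p.1 - b • p.2) •
      Complex.exp (inner ℝ p.1 k * Complex.I)) (volume.prod μ) := by
    have hc : Continuous fun p : Space d × Space d => rho s (p.1 - b • p.2) •
        Complex.exp (inner ℝ p.1 k * Complex.I) :=
      ((continuous_rho s).comp (by fun_prop)).smul (by fun_prop)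
    refine (integrable_prod_rho μ hs b).mono hc.aestronglyMeasurable
      (Eventually.of_forall fun p => ?_)
    rw [norm_smul, Complex.norm_exp_ofReal_mul_I, mul_one]
  simp_rw [gaussMix, ← integral_smul_const]
  rw [integral_integral_swap hint]
  simp_rw [integral_rho_sub_smul_cexp hs]
  rw [integral_mul_const, charFun_apply]
  simp_rw [inner_smul_left, inner_smul_right]
  simp

instance isFiniteMeasure_withDensity_gaussMix {s : ℝ} [Fact (0 < s)] {b : ℝ} :
    IsFiniteMeasure (volume.withDensity fun x => ENNReal.ofReal (gaussMix μ s b x)) :=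
  isFiniteMeasure_withDensity_ofReal (integrable_gaussMix μ Fact.out b).2

theorem aemeasurable_gaussMix {s : ℝ} (hs : 0 < s) (b : ℝ) :
    AEMeasurable (gaussMix μ s b) :=
  (integrable_gaussMix μ hs b).aemeasurable

theorem integral_withDensity_gaussMix {s : ℝ} (hs : 0 < s) (b : ℝ) (f : Space d → ℂ) :
    ∫ x, f x ∂(volume.withDensity fun x => ENNReal.ofReal (gaussMix μ s b x)) =
      ∫ x, gaussMix μ s b x • f x := by
  rw [integral_withDensity_eq_integral_toReal_smul₀ (aemeasurable_gaussMix μ hs b).ennreal_ofReal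
    (Eventually.of_forall fun _ => ENNReal.ofReal_lt_top)]
  simp_rw [ENNReal.toReal_ofReal (gaussMix_nonneg μ s b _)]

theorem charFun_withDensity_gaussMix {s : ℝ} (hs : 0 < s) (b : ℝ) (k : Space d) :
    charFun (volume.withDensity fun x => ENNReal.ofReal (gaussMix μ s b x)) k =
      charFun μ (b • k) * Complex.exp (-(s ^ 2 * ‖k‖ ^ 2 / 2 : ℝ)) := by
  rw [charFun_apply, integral_withDensity_gaussMix μ hs, integral_gaussMix_smul_cexp μ hs]

/-- For b = 0 the mixture forgets μ, so the law of the initial value is the time-zero member of the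
transported family. -/
theorem stdGaussian_eq_withDensity :
    stdGaussian (Space d) = volume.withDensity fun x => ENNReal.ofReal (gaussMix μ 1 0 x) := by
  have : Fact ((0 : ℝ) < 1) := ⟨one_pos⟩
  refine Measure.ext_of_charFun (funext fun k => ?_)
  rw [charFun_withDensity_gaussMix μ one_pos, charFun_stdGaussian]
  simp [neg_div]

variable {Ω : Type*} [MeasurableSpace Ω] {P : Measure Ω} [IsProbabilityMeasure P]

theorem IsStdNormal.map_eq {X : Ω → Space d} (hX : IsStdNormal P X) :
    P.map X = stdGaussian (Space d) := by
  have hm : ∀ i, Measurable fun ω => X ω i := fun i => by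
    have := hX.measurable
    fun_prop
  have h1 := (iIndepFun_iff_map_fun_eq_pi_map fun i => (hm i).aemeasurable).1 hX.indep
  simp_rw [hX.law] at h1
  have h2 : Measurable (WithLp.toLp 2 : (Fin d → ℝ) → Space d) := by fun_prop
  have h3 : Measurable fun ω i => X ω i := measurable_pi_lambda _ hm
  rw [← map_pi_eq_stdGaussian, ← h1]
  exact (Measure.map_map h2 h3).symm

theorem map_add_stdNormal_eq {η ξ : Ω → Space d} (hη : Measurable η) (hlaw : P.map η = μ)
    (hξ : IsStdNormal P ξ) (hi : IndepFun η ξ P) {s : ℝ} (hs : 0 < s) (b : ℝ) :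
    P.map (fun ω => b • η ω + s • ξ ω) =
      volume.withDensity fun x => ENNReal.ofReal (gaussMix μ s b x) := by
  have : Fact (0 < s) := ⟨hs⟩
  have hm := hξ.measurable
  refine Measure.ext_of_charFun (funext fun k => ?_)
  have hi' : IndepFun (fun ω => b • η ω) (fun ω => s • ξ ω) P :=
    hi.comp (measurable_const_smul b) (measurable_const_smul s)
  rw [hi'.charFun_map_fun_add_eq_mul (by fun_prop) (by fun_prop), Pi.mul_apply,
    charFun_withDensity_gaussMix μ hs]
  have h1 : P.map (fun ω => b • η ω) = μ.map (b • ·) := by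
    rw [← hlaw, Measure.map_map (by fun_prop) hη]; rfl
  have h2 : P.map (fun ω => s • ξ ω) = (stdGaussian (Space d)).map (s • ·) := by
    rw [← hξ.map_eq, Measure.map_map (by fun_prop) hm]; rfl
  rw [h1, h2, charFun_map_smul, charFun_map_smul, charFun_stdGaussian, norm_smul, Real.norm_eq_abs]
  congr 2
  push_cast
  rw [mul_pow, ← Complex.ofReal_pow, sq_abs]
  push_cast
  ring

variable {μ} {R : ℝ} {Φ : ℝ → Space d → ℝ → Space d}

theorem lipschitzWith_cexp_inner (k : Space d) :
    LipschitzWith ‖k‖₊ fun x : Space d => Complex.exp (inner ℝ x k * Complex.I) := by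
  refine LipschitzWith.of_dist_le_mul fun x y => ?_
  rw [dist_eq_norm, dist_eq_norm, mul_comm (inner ℝ x k : ℂ), mul_comm (inner ℝ y k : ℂ)]
  have h1 : Complex.exp (Complex.I * (inner ℝ x k : ℝ)) -
      Complex.exp (Complex.I * (inner ℝ y k : ℝ)) =
      Complex.exp (Complex.I * (inner ℝ y k : ℝ)) *
        (Complex.exp (Complex.I * (inner ℝ (x - y) k : ℝ)) - 1) := by
    rw [mul_sub, ← Complex.exp_add, inner_sub_left]
    push_cast
    ring_nf
  rw [h1, norm_mul, mul_comm Complex.I, Complex.norm_exp_ofReal_mul_I, one_mul]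
  refine (Real.norm_exp_I_mul_ofReal_sub_one_le).trans ?_
  rw [mul_comm]
  exact norm_inner_le_norm _ _

/-- The conserved integral, between times 0 and u, is applied to the character with frequency s • k;
the scaling by s turns mixture parameters (1, u) into (s, su). -/
theorem map_smul_flow_eq (hR : ∀ᵐ y ∂μ, ‖y‖ ≤ R)
    (hΦ : ∀ s x, Φ s x s = x ∧ IsIntegralCurve (Φ s x) (tiltMean μ)) {X : Ω → Space d}
    (hX : IsStdNormal P X) {s : ℝ} (hs : 0 < s) (u : ℝ) :
    P.map (fun ω => s • Φ 0 (X ω) u) =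
      volume.withDensity fun x => ENNReal.ofReal (gaussMix μ s (s * u) x) := by
  have : Fact (0 < s) := ⟨hs⟩
  have hm := hX.measurable
  have hflow : Measurable fun x => Φ 0 x u := (continuous_flow hR hΦ 0 u).measurable
  refine Measure.ext_of_charFun (funext fun k => ?_)
  have h1 : P.map (fun ω => s • Φ 0 (X ω) u) =
      ((stdGaussian (Space d)).map fun x => Φ 0 x u).map (s • ·) := by
    rw [← hX.map_eq, Measure.map_map hflow hm, Measure.map_map (by fun_prop) (hflow.comp hm)]
    rfl
  rw [h1, charFun_map_smul, charFun_withDensity_gaussMix μ hs, charFun_apply,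
    integral_map hflow.aemeasurable (by fun_prop), stdGaussian_eq_withDensity μ,
    integral_withDensity_gaussMix μ one_pos,
    integral_gaussMix_smul_flow hR hΦ (lipschitzWith_cexp_inner (s • k))
      (fun x => (Complex.norm_exp_ofReal_mul_I _).le), integral_gaussMix_smul_cexp μ one_pos,
    smul_smul, mul_comm u, norm_smul, Real.norm_eq_abs, mul_pow, sq_abs, one_pow, one_mul]

end CharFun
-- Estimates in the ℓ^q-norm
section LqNorm

variable {d : ℕ} (q : ℝ≥0∞) [Fact (1 ≤ q)]

/-- The identity of `ℝ^d` as a linear isomorphism from the Euclidean to the `ℓ^q`-norm. -/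
noncomputable def lqEquiv : Space d ≃L[ℝ] PiLp q (fun _ : Fin d => ℝ) :=
  ((WithLp.linearEquiv 2 ℝ (Fin d → ℝ)).trans
    (WithLp.linearEquiv q ℝ (Fin d → ℝ)).symm).toContinuousLinearEquiv

theorem lqNorm_eq (x : Space d) : lqNorm q x = ‖lqEquiv q x‖ := rfl

theorem continuous_lqNorm : Continuous (lqNorm q : Space d → ℝ) :=
  (lqEquiv q).continuous.norm

theorem lqNorm_nonneg (x : Space d) : 0 ≤ lqNorm q x := norm_nonneg _

theorem lqNorm_sub_le (x y : Space d) : lqNorm q (x - y) ≤ lqNorm q x + lqNorm q y := by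
  simp only [lqNorm_eq, map_sub]
  exact norm_sub_le _ _

theorem lqNorm_smul (c : ℝ) (x : Space d) : lqNorm q (c • x) = |c| * lqNorm q x := by
  simp only [lqNorm_eq, map_smul, norm_smul, Real.norm_eq_abs]

theorem exists_norm_le_mul_lqNorm : ∃ C : ℝ, 0 ≤ C ∧ ∀ x : Space d, ‖x‖ ≤ C * lqNorm q x := by
  refine ⟨‖((lqEquiv (d := d) q).symm : PiLp q (fun _ : Fin d => ℝ) →L[ℝ] Space d)‖, norm_nonneg _,
    fun x => ?_⟩
  simpa [lqNorm_eq] using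
    ((lqEquiv (d := d) q).symm : PiLp q (fun _ : Fin d => ℝ) →L[ℝ] Space d).le_opNorm (lqEquiv q x)

theorem exists_lqNorm_le_mul_norm : ∃ C : ℝ, 0 ≤ C ∧ ∀ x : Space d, lqNorm q x ≤ C * ‖x‖ :=
  ⟨‖(lqEquiv (d := d) q : Space d →L[ℝ] PiLp q (fun _ : Fin d => ℝ))‖, norm_nonneg _, fun x =>
    (lqEquiv (d := d) q : Space d →L[ℝ] PiLp q (fun _ : Fin d => ℝ)).le_opNorm x⟩

variable {μ : Measure (Space d)} [IsProbabilityMeasure μ] {R : ℝ}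
  {Φ : ℝ → Space d → ℝ → Space d}

/-- The tilted mean minus z is a weighted average of y - z, so any norm bound on y - z is inherited.
-/
theorem lqNorm_tiltMean_sub_le (hR : ∀ᵐ y ∂μ, ‖y‖ ≤ R) {z : Space d} {S : ℝ}
    (hS : ∀ᵐ y ∂μ, lqNorm q (y - z) ≤ S) (u : ℝ) (x : Space d) :
    lqNorm q (tiltMean μ u x - z) ≤ S := by
  have hZ := tiltMass_pos hR u x
  let A : Space d →L[ℝ] PiLp q (fun _ : Fin d => ℝ) := lqEquiv (d := d) q
  have h1 : lqEquiv q (tiltMean μ u x - z) =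
      (tiltMass μ u x)⁻¹ • tiltInt μ (fun y => A (y - z)) u x := by
    have h2 : tiltInt μ (fun y => A (y - z)) u x = A (tiltInt μ (fun y => y - z) u x) := by
      simp_rw [tiltInt, ← map_smul A]
      exact A.integral_comp_comm (integrable_tilt_smul hR (by fun_prop) u x)
    have h3 : tiltInt μ (fun y => y - z) u x = tiltInt μ (fun y => y) u x - tiltMass μ u x • z := by
      simp_rw [tiltInt, smul_sub]
      rw [integral_sub (integrable_tilt_smul hR continuous_id' u x)
        (integrable_tilt_smul hR continuous_const u x), integral_smul_const, tiltMass]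
    rw [h2, h3, ← map_smul, smul_sub, inv_smul_smul₀ hZ.ne']
    rfl
  rw [lqNorm_eq, h1, norm_smul, norm_inv, Real.norm_of_nonneg hZ.le, inv_mul_le_iff₀ hZ]
  exact norm_tiltInt_le hR hS u x

theorem lqNorm_flow_sub_le (hR : ∀ᵐ y ∂μ, ‖y‖ ≤ R)
    (hΦ : ∀ s x, Φ s x s = x ∧ IsIntegralCurve (Φ s x) (tiltMean μ)) {z : Space d} {S : ℝ}
    (hS : ∀ᵐ y ∂μ, lqNorm q (y - z) ≤ S) {u : ℝ} (hu : 0 ≤ u) (x : Space d) :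
    lqNorm q (Φ 0 x u - u • z) ≤ lqNorm q x + u * S := by
  have hd : ∀ t, HasDerivAt (fun t => lqEquiv q (Φ 0 x t - t • z))
      (lqEquiv q (tiltMean μ t (Φ 0 x t) - z)) t := by
    intro t
    have h1 : HasDerivAt (fun t => Φ 0 x t - t • z) (tiltMean μ t (Φ 0 x t) - z) t := by
      have := ((hΦ 0 x).2 t).sub ((hasDerivAt_id t).smul_const z)
      exact HasDerivAt.congr_deriv this (by simp)
    exact (lqEquiv (d := d) q : Space d →L[ℝ]
      PiLp q (fun _ : Fin d => ℝ)).hasFDerivAt.comp_hasDerivAt t h1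
  have := convex_univ.norm_image_sub_le_of_norm_hasDerivWithin_le (𝕜 := ℝ)
    (f := fun t => lqEquiv q (Φ 0 x t - t • z)) (x := 0) (y := u) (C := S)
    (fun t _ => (hd t).hasDerivWithinAt) (fun t _ => lqNorm_tiltMean_sub_le q hR hS _ _)
    (mem_univ _) (mem_univ _)
  simp only [(hΦ 0 x).1, zero_smul, sub_zero, Real.norm_of_nonneg hu] at this
  have h2 := norm_le_norm_add_norm_sub' (lqEquiv q (Φ 0 x u - u • z)) (lqEquiv q x)
  simp only [lqNorm_eq]
  linarith

end LqNorm

/-! ### Consequences of (H) on the time interval -/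

section TimeInterval

variable {T : EReal}

theorem exists_gt_mem_timeInterval {t : ℝ} (ht : t ∈ timeInterval T) :
    ∃ b ∈ timeInterval T, t < b := by
  obtain ⟨b, h1, h2⟩ := EReal.lt_iff_exists_real_btwn.1 ht.2
  have h1' : t < b := EReal.coe_lt_coe_iff.1 h1
  exact ⟨b, ⟨ht.1.trans h1'.le, h2⟩, h1'⟩

theorem zero_mem_timeInterval (hT : 0 < T) : (0 : ℝ) ∈ timeInterval T :=
  ⟨le_rfl, by simpa using hT⟩

theorem Icc_subset_timeInterval {b : ℝ} (hb : b ∈ timeInterval T) :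
    Icc 0 b ⊆ timeInterval T := fun _ ht =>
  ⟨ht.1, (EReal.coe_le_coe_iff.2 ht.2).trans_lt hb.2⟩

theorem timeInterval_mem_nhdsGE {t : ℝ} (ht : t ∈ timeInterval T) :
    timeInterval T ∈ 𝓝[≥] t := by
  obtain ⟨b, hb, htb⟩ := exists_gt_mem_timeInterval ht
  exact mem_of_superset (Icc_mem_nhdsGE htb)
    ((Icc_subset_Icc_left ht.1).trans (Icc_subset_timeInterval hb))

theorem uniqueDiffOn_timeInterval : UniqueDiffOn ℝ (timeInterval T) := fun _ ht =>
  (uniqueDiffWithinAt_Ici _).mono_nhds (nhdsWithin_le_iff.2 (timeInterval_mem_nhdsGE ht))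

variable {σ : ℝ → ℝ} (hσ : HypH T σ)
include hσ

/-- The interval has no largest element, and σ is nonnegative and strictly smaller at a later time.
-/
theorem HypH.pos {t : ℝ} (ht : t ∈ timeInterval T) : 0 < σ t := by
  obtain ⟨b, hb, htb⟩ := exists_gt_mem_timeInterval ht
  exact (hσ.nonneg b hb).trans_lt (hσ.strictAntiOn ht hb htb)

theorem HypH.apply_zero (hT : 0 < T) : σ 0 = 1 := by
  have h0 := zero_mem_timeInterval hT
  have h1 : Tendsto σ (𝓝[>] 0) (𝓝 (σ 0)) := (hσ.continuousOn 0 h0).mono_left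
    ((nhdsWithin_mono _ Ioi_subset_Ici_self).trans
      (nhdsWithin_le_iff.2 (timeInterval_mem_nhdsGE h0)))
  exact tendsto_nhds_unique h1 hσ.tendsto_zero

theorem HypH.beta_nonneg (hT : 0 < T) {t : ℝ} (ht : t ∈ timeInterval T) : 0 ≤ beta σ t := by
  have := hσ.strictAntiOn.antitoneOn (zero_mem_timeInterval hT) ht ht.1
  rw [hσ.apply_zero hT] at this
  exact sub_nonneg.2 this

theorem HypH.hasDerivWithinAt {t : ℝ} (ht : t ∈ timeInterval T) :
    HasDerivWithinAt σ (derivWithin σ (timeInterval T) t) (timeInterval T) t :=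
  (hσ.differentiableOn t ht).hasDerivWithinAt

theorem HypH.derivWithin_log {t : ℝ} (ht : t ∈ timeInterval T) :
    derivWithin (fun s => Real.log (σ s)) (timeInterval T) t =
      derivWithin σ (timeInterval T) t / σ t :=
  ((hσ.hasDerivWithinAt ht).log (hσ.pos ht).ne').derivWithin (uniqueDiffOn_timeInterval t ht)

theorem HypH.hasDerivWithinAt_beta_div {t : ℝ} (ht : t ∈ timeInterval T) :
    HasDerivWithinAt (fun s => beta σ s / σ s) (-derivWithin σ (timeInterval T) t / σ t ^ 2)
      (timeInterval T) t := by
  have h := ((hσ.hasDerivWithinAt ht).const_sub 1).div (hσ.hasDerivWithinAt ht) (hσ.pos ht).ne'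
  refine HasDerivWithinAt.congr_deriv h ?_
  congr 1
  ring

end TimeInterval

/-! ### Change of variables in the ODE, existence and uniqueness -/

section Ode

variable {d : ℕ} {μ : Measure (Space d)} {T : EReal} {σ : ℝ → ℝ}

theorem rho_sub_smul_eq {s : ℝ} (hs : 0 < s) (b : ℝ) (x y : Space d) :
    rho s (x - b • y) = rho s x * tilt (b / s) (s⁻¹ • x) y := by
  rw [rho, rho, tilt, mul_assoc _ (Real.exp _), ← Real.exp_add, norm_sub_sq_real, norm_smul,
    inner_smul_right, inner_smul_left, mul_pow, Real.norm_eq_abs, sq_abs]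
  congr 2
  simp
  field_simp
  ring

theorem denoiser_eq_tiltMean {t : ℝ} (ht : 0 < σ t) (x : Space d) :
    denoiser σ μ t x = tiltMean μ (beta σ t / σ t) ((σ t)⁻¹ • x) := by
  have hpos : 0 < rho (σ t) x := by
    unfold rho
    positivity
  simp_rw [denoiser, rho_sub_smul_eq ht, mul_smul, integral_const_mul, integral_smul]
  rw [mul_inv, mul_comm, mul_smul, inv_smul_smul₀ hpos.ne']
  rfl

/-- In (y/σ)' the contributions -σ'y/σ² and σ'y/σ² cancel, leaving only the denoiser term, with
factor (β/σ)' = -σ'/σ². -/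
theorem isSolution_iff (hσ : HypH T σ) {x₀ : Space d} {y : ℝ → Space d} :
    IsSolution T σ μ x₀ y ↔ y 0 = x₀ ∧ ∀ t ∈ timeInterval T,
      HasDerivWithinAt (fun t => (σ t)⁻¹ • y t) ((-derivWithin σ (timeInterval T) t / σ t ^ 2) •
        tiltMean μ (beta σ t / σ t) ((σ t)⁻¹ • y t)) (timeInterval T) t := by
  have key : ∀ t ∈ timeInterval T, HasDerivWithinAt y (drift T σ μ t (y t)) (timeInterval T) t ↔
      HasDerivWithinAt (fun t => (σ t)⁻¹ • y t) ((-derivWithin σ (timeInterval T) t / σ t ^ 2) •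
        tiltMean μ (beta σ t / σ t) ((σ t)⁻¹ • y t)) (timeInterval T) t := by
    intro t ht
    have hp := (hσ.pos ht).ne'
    rw [drift, hσ.derivWithin_log ht, denoiser_eq_tiltMean (hσ.pos ht)]
    set D := tiltMean μ (beta σ t / σ t) ((σ t)⁻¹ • y t)
    set σ' := derivWithin σ (timeInterval T) t with hσ'
    have hd := hσ.hasDerivWithinAt ht
    rw [← hσ'] at hd
    constructor
    · intro h
      refine HasDerivWithinAt.congr_deriv ((hd.inv hp).smul h) ?_
      simp only [smul_sub, smul_smul, Pi.inv_apply]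
      have h1 : (σ t)⁻¹ * (σ' / σ t) = σ' / σ t ^ 2 := by field_simp
      rw [h1, neg_div, neg_smul, neg_smul]
      abel
    · intro h
      have h2 := hd.smul h
      refine (HasDerivWithinAt.congr_deriv h2 ?_).congr (fun s hs => ?_) ?_
      · simp only [smul_sub, smul_smul]
        have h1 : σ t * (-σ' / σ t ^ 2) = -(σ' / σ t) := by field_simp
        rw [h1, ← div_eq_mul_inv, neg_smul]
        abel
      · exact (smul_inv_smul₀ (hσ.pos hs).ne' _).symm
      · exact (smul_inv_smul₀ hp _).symm
  exact ⟨fun h => ⟨h.init, fun t ht => (key t ht).1 (h.ode t ht)⟩,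
    fun h => ⟨h.1, fun t ht => (key t ht).2 (h.2 t ht)⟩⟩

variable {Φ : ℝ → Space d → ℝ → Space d}

theorem isSolution_smul_flow (hσ : HypH T σ) (hT : 0 < T)
    (hΦ : ∀ s x, Φ s x s = x ∧ IsIntegralCurve (Φ s x) (tiltMean μ)) (x : Space d) :
    IsSolution T σ μ x fun t => σ t • Φ 0 x (beta σ t / σ t) := by
  rw [isSolution_iff hσ]
  refine ⟨by simp [hσ.apply_zero hT, beta, (hΦ 0 x).1], fun t ht => ?_⟩
  simp only [inv_smul_smul₀ (hσ.pos ht).ne']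
  refine (((hΦ 0 x).2 (beta σ t / σ t)).scomp_hasDerivWithinAt t
    (hσ.hasDerivWithinAt_beta_div ht)).congr (fun s hs => ?_) ?_
  · exact inv_smul_smul₀ (hσ.pos hs).ne' _
  · exact inv_smul_smul₀ (hσ.pos ht).ne' _

variable [IsProbabilityMeasure μ] {R : ℝ}

/-- On [0, t] one has σ_s ≥ σ_t > 0, so the time factor is at most C/σ_t² and the tilt parameter at
most 1/σ_t; the rescaled field is thus uniformly Lipschitz. -/
theorem isSolution_unique (hσ : HypH T σ) (hT : 0 < T) (hR : ∀ᵐ y ∂μ, ‖y‖ ≤ R) {x : Space d}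
    {y₁ y₂ : ℝ → Space d} (h₁ : IsSolution T σ μ x y₁) (h₂ : IsSolution T σ μ x y₂) :
    EqOn y₁ y₂ (timeInterval T) := by
  intro t ht
  rcases ht.1.eq_or_lt with h0 | h0
  · rw [← h0, h₁.init, h₂.init]
  rw [isSolution_iff hσ] at h₁ h₂
  obtain ⟨C, hC⟩ := hσ.deriv_bounded t h0 ht.2
  have hsub := Icc_subset_timeInterval ht
  have hR0 : 0 ≤ R := (norm_nonneg _).trans (norm_tiltMean_le hR 0 0)
  have hσt := hσ.pos ht
  have hanti : ∀ s ∈ Icc 0 t, σ t ≤ σ s := fun s hs =>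
    hσ.strictAntiOn.antitoneOn (hsub hs) ht hs.2
  have hlip : ∀ s ∈ Ico 0 t, LipschitzOnWith
      ((C / σ t ^ 2).toNNReal * (2 * (1 / σ t * R ^ 2)).toNNReal)
      (fun x => (-derivWithin σ (timeInterval T) s / σ s ^ 2) • tiltMean μ (beta σ s / σ s) x)
      univ := by
    intro s hs
    have hs' := Ico_subset_Icc_self hs
    have hσs := hσ.pos (hsub hs')
    have hC0 : 0 ≤ C := (abs_nonneg _).trans (hC s hs')
    refine (((lipschitzWith_smul _).comp (lipschitzWith_tiltMean hR _)).weaken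
      (mul_le_mul' ?_ (Real.toNNReal_le_toNNReal ?_))).lipschitzOnWith
    · rw [← NNReal.coe_le_coe, coe_nnnorm, Real.coe_toNNReal _ (by positivity), norm_div, norm_neg,
        Real.norm_eq_abs, Real.norm_of_nonneg (by positivity)]
      gcongr
      · exact hC s hs'
      · exact hanti s hs'
    · have hb : beta σ s ≤ 1 := by
        unfold beta
        linarith
      rw [abs_div, abs_of_pos hσs, abs_of_nonneg (hσ.beta_nonneg hT (hsub hs'))]
      gcongr
      exact hanti s hs'
  have hode : ∀ {y : ℝ → Space d}, (∀ t ∈ timeInterval T,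
      HasDerivWithinAt (fun t => (σ t)⁻¹ • y t) ((-derivWithin σ (timeInterval T) t / σ t ^ 2) •
        tiltMean μ (beta σ t / σ t) ((σ t)⁻¹ • y t)) (timeInterval T) t) →
      ∀ s ∈ Ico 0 t, HasDerivWithinAt (fun t => (σ t)⁻¹ • y t)
        ((-derivWithin σ (timeInterval T) s / σ s ^ 2) •
        tiltMean μ (beta σ s / σ s) ((σ s)⁻¹ • y s)) (Ici s) s := fun h s hs =>
    (h s (hsub (Ico_subset_Icc_self hs))).mono_of_mem_nhdsWithin
      (timeInterval_mem_nhdsGE (hsub (Ico_subset_Icc_self hs)))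
  have heq := ODE_solution_unique_of_mem_Icc_right hlip
    (fun s hs => ((h₁.2 s (hsub hs)).continuousWithinAt).mono hsub) (hode h₁.2) (fun _ _ => trivial)
    (fun s hs => ((h₂.2 s (hsub hs)).continuousWithinAt).mono hsub) (hode h₂.2) (fun _ _ => trivial)
    (by simp only [h₁.1, h₂.1]) (right_mem_Icc.2 h0.le)
  exact smul_right_injective _ (inv_ne_zero hσt.ne') heq

end Ode
-- Gaussian tails in the maximum norm
section Tail

theorem gaussianReal_real_Ioi (M : ℝ) :
    (gaussianReal 0 1).real (Ioi M) = erfc (M / √2) / 2 := by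
  rw [measureReal_def, gaussianReal_apply_eq_integral 0 one_ne_zero,
    ENNReal.toReal_ofReal (setIntegral_nonneg measurableSet_Ioi fun x _ =>
      gaussianPDFReal_nonneg 0 1 x)]
  have h2 : (0 : ℝ) < √2 := by positivity
  have h := integral_comp_mul_left_Ioi (fun x => Real.exp (-x ^ 2)) M (inv_pos.2 h2)
  have h3 : ∀ x : ℝ, gaussianPDFReal 0 1 x =
      (√(2 * Real.pi))⁻¹ * Real.exp (-((√2)⁻¹ * x) ^ 2) := by
    intro x
    simp only [gaussianPDFReal, NNReal.coe_one, mul_one, sub_zero]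
    congr 2
    rw [mul_pow, inv_pow, Real.sq_sqrt (by norm_num)]
    ring
  simp_rw [h3]
  rw [integral_const_mul, h, erfc, inv_inv, smul_eq_mul, Real.sqrt_mul (by norm_num),
    div_eq_inv_mul M]
  field_simp

theorem gaussianReal_real_Ioo (M : ℝ) (hM : 0 < M) :
    (gaussianReal 0 1).real (Ioo (-M) M) = 1 - erfc (M / √2) := by
  have hna := nullSingletonClass_gaussianReal (μ := 0) (v := 1) one_ne_zero
  have h1 : (Ioo (-M) M)ᶜ = Iic (-M) ∪ Ici M := by
    ext x
    simp only [mem_compl_iff, mem_Ioo, not_and_or, not_lt, mem_union, mem_Iic, mem_Ici]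
  have h2 : (gaussianReal 0 1).real (Ici M) = erfc (M / √2) / 2 := by
    rw [← gaussianReal_real_Ioi, measureReal_def, measureReal_def, measure_congr Ioi_ae_eq_Ici]
  have h3 : (gaussianReal 0 1).real (Iic (-M)) = erfc (M / √2) / 2 := by
    have h := gaussianReal_map_neg (μ := 0) (v := 1)
    rw [neg_zero] at h
    rw [← h2, ← h, map_measureReal_apply measurable_neg measurableSet_Iic, h]
    congr 1
    ext x
    simp
  have h4 := probReal_compl_eq_one_sub (μ := gaussianReal 0 1)
    (measurableSet_Ioo (a := -M) (b := M))
  rw [h1, measureReal_union (by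
    rw [Set.disjoint_left]
    intro x hx hx'
    simp only [mem_Iic, mem_Ici] at hx hx'
    linarith) measurableSet_Ici, h2, h3] at h4
  linarith

variable {d : ℕ} {Ω : Type*} [MeasurableSpace Ω] {P : Measure Ω} [IsProbabilityMeasure P]

theorem IsStdNormal.measureReal_le_lqNorm_top {X : Ω → Space d} (hX : IsStdNormal P X) {M : ℝ}
    (hM : 0 < M) :
    P.real {ω | M ≤ lqNorm ∞ (X ω)} = 1 - (1 - erfc (M / √2)) ^ d := by
  have hm : ∀ i, Measurable fun ω => X ω i := fun i => by
    have := hX.measurable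
    fun_prop
  have hset : {ω | M ≤ lqNorm ∞ (X ω)} = (⋂ i, (fun ω => X ω i) ⁻¹' Ioo (-M) M)ᶜ := by
    ext ω
    simp only [mem_ofPred_eq, lqNorm, mem_compl_iff, mem_iInter, mem_preimage, mem_Ioo]
    rw [PiLp.norm_toLp, ← not_lt, pi_norm_lt_iff hM]
    simp only [Real.norm_eq_abs, abs_lt]
  have hprod : P.real (⋂ i, (fun ω => X ω i) ⁻¹' Ioo (-M) M) = (1 - erfc (M / √2)) ^ d := by
    rw [measureReal_def, hX.indep.meas_iInter fun i => ⟨_, measurableSet_Ioo, rfl⟩,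
      ENNReal.toReal_prod]
    have : ∀ i, (P ((fun ω => X ω i) ⁻¹' Ioo (-M) M)).toReal = 1 - erfc (M / √2) := by
      intro i
      rw [← gaussianReal_real_Ioo M hM, ← hX.law i, measureReal_def,
        Measure.map_apply (hm i) measurableSet_Ioo]
    simp [this]
  rw [hset, probReal_compl_eq_one_sub (MeasurableSet.iInter fun i => hm i measurableSet_Ioo), hprod]

end Tail

/-! ### The Wasserstein bound and essential suprema -/

section Wasserstein

variable {d : ℕ} {Ω : Type*} [MeasurableSpace Ω] {P : Measure Ω} [IsProbabilityMeasure P]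
  (q : ℝ≥0∞) [Fact (1 ≤ q)]

theorem IsStdNormal.integrable_lqNorm_rpow {X : Ω → Space d} (hX : IsStdNormal P X) {p : ℝ}
    (hp : 0 < p) : Integrable (fun ω => lqNorm q (X ω) ^ p) P := by
  have h1 : MemLp X (ENNReal.ofReal p) P := by
    have := IsGaussian.memLp_id (stdGaussian (Space d)) (ENNReal.ofReal p) ENNReal.ofReal_ne_top
    rw [← hX.map_eq] at this
    exact (memLp_map_measure_iff aestronglyMeasurable_id hX.measurable.aemeasurable).1 this
  have h2 := (lqEquiv (d := d) q : Space d →L[ℝ] PiLp q (fun _ : Fin d => ℝ)).comp_memLp' h1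
  have h3 := h2.integrable_norm_rpow (by simpa using hp) ENNReal.ofReal_ne_top
  rw [ENNReal.toReal_ofReal hp.le] at h3
  exact h3

omit [IsProbabilityMeasure P] in
theorem wasserstein_map_le {X Z : Ω → Space d} (hX : Measurable X) (hZ : Measurable Z) (p : ℝ) :
    wasserstein q p (P.map X) (P.map Z) ≤
      (∫⁻ ω, ENNReal.ofReal (lqNorm q (X ω - Z ω) ^ p) ∂P) ^ (1 / p) := by
  have h1 : (P.map fun ω => (X ω, Z ω)).map Prod.fst = P.map X := by
    rw [Measure.map_map measurable_fst (hX.prodMk hZ)]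
    rfl
  have h2 : (P.map fun ω => (X ω, Z ω)).map Prod.snd = P.map Z := by
    rw [Measure.map_map measurable_snd (hX.prodMk hZ)]
    rfl
  refine (iInf₂_le (P.map fun ω => (X ω, Z ω)) ⟨h1, h2⟩).trans_eq ?_
  have := (continuous_lqNorm (d := d) q).measurable
  rw [lintegral_map (by fun_prop) (hX.prodMk hZ)]

/-- Coupling both laws through the same η leaves the difference s(X - η); then Minkowski's
inequality in L^p. -/
theorem wasserstein_convex_combination_le {X η : Ω → Space d} (hX : IsStdNormal P X)
    (hη : Measurable η) {K : ℝ} (hK : ∀ᵐ ω ∂P, lqNorm q (η ω) ≤ K) {s p : ℝ} (hs : 0 ≤ s)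
    (hp : 1 ≤ p) :
    wasserstein q p (P.map fun ω => (1 - s) • η ω + s • X ω) (P.map η) ≤
      ENNReal.ofReal ((K + (∫ ω, lqNorm q (X ω) ^ p ∂P) ^ (1 / p)) * s) := by
  have hp0 : 0 < p := one_pos.trans_le hp
  have hm := hX.measurable
  have hlq := (continuous_lqNorm (d := d) q).measurable
  have hK0 : 0 ≤ K := by
    obtain ⟨ω, hω⟩ := hK.exists
    exact (lqNorm_nonneg q _).trans hω
  refine (wasserstein_map_le q (by fun_prop) hη p).trans ?_
  have h1 : ∫⁻ ω, ENNReal.ofReal (lqNorm q ((1 - s) • η ω + s • X ω - η ω) ^ p) ∂P ≤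
      ∫⁻ ω, ((fun _ => ENNReal.ofReal (s * K) : Ω → ℝ≥0∞) +
        (fun ω => ENNReal.ofReal (s * lqNorm q (X ω)) : Ω → ℝ≥0∞)) ω ^ p ∂P := by
    refine lintegral_mono_ae ?_
    filter_upwards [hK] with ω hω
    have h2 : (1 - s) • η ω + s • X ω - η ω = s • (X ω - η ω) := by module
    rw [h2, lqNorm_smul, abs_of_nonneg hs, Pi.add_apply, ← ENNReal.ofReal_add (by positivity)
      (mul_nonneg hs (lqNorm_nonneg q _)), ENNReal.ofReal_rpow_of_nonneg _ hp0.le]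
    · refine ENNReal.ofReal_le_ofReal (Real.rpow_le_rpow (mul_nonneg hs (lqNorm_nonneg q _)) ?_
        hp0.le)
      rw [← mul_add]
      refine mul_le_mul_of_nonneg_left ?_ hs
      linarith [lqNorm_sub_le q (X ω) (η ω)]
    · exact add_nonneg (by positivity) (mul_nonneg hs (lqNorm_nonneg q _))
  refine (ENNReal.rpow_le_rpow h1 (by positivity)).trans ?_
  refine (ENNReal.lintegral_Lp_add_le (by fun_prop) (by fun_prop) hp).trans ?_
  have h3 : (∫⁻ _, ENNReal.ofReal (s * K) ^ p ∂P) ^ (1 / p) = ENNReal.ofReal (s * K) := by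
    rw [lintegral_const, measure_univ, mul_one, one_div, ENNReal.rpow_rpow_inv hp0.ne']
  have h4 : (∫⁻ ω, ENNReal.ofReal (s * lqNorm q (X ω)) ^ p ∂P) ^ (1 / p) =
      ENNReal.ofReal (s * (∫ ω, lqNorm q (X ω) ^ p ∂P) ^ (1 / p)) := by
    have h5 : ∀ ω, ENNReal.ofReal (s * lqNorm q (X ω)) ^ p =
        ENNReal.ofReal s ^ p * ENNReal.ofReal (lqNorm q (X ω) ^ p) := by
      intro ω
      rw [ENNReal.ofReal_mul hs, ENNReal.mul_rpow_of_nonneg _ _ hp0.le,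
        ENNReal.ofReal_rpow_of_nonneg (lqNorm_nonneg q _) hp0.le]
    have hnn : ∀ ω, 0 ≤ lqNorm q (X ω) ^ p := fun ω => Real.rpow_nonneg (lqNorm_nonneg q _) _
    simp_rw [h5]
    rw [lintegral_const_mul _ (by fun_prop), ← ofReal_integral_eq_lintegral_ofReal
      (hX.integrable_lqNorm_rpow q hp0) (Eventually.of_forall hnn),
      ENNReal.mul_rpow_of_nonneg _ _ (by positivity), one_div, ENNReal.rpow_rpow_inv hp0.ne',
      ENNReal.ofReal_rpow_of_nonneg (integral_nonneg hnn) (by positivity), ENNReal.ofReal_mul hs]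
  rw [h3, h4, ← ENNReal.ofReal_add (by positivity) (mul_nonneg hs (Real.rpow_nonneg
    (integral_nonneg fun ω => Real.rpow_nonneg (lqNorm_nonneg q _) _) _)), ← mul_add, mul_comm]

omit [IsProbabilityMeasure P] in
-- A real-valued `essSup` is an upper bound only for essentially bounded functions. Equivalence of
-- norms carries boundedness from q' to q, which the maximum norm requires.
theorem lqNorm_sub_le_essSup {q' : ℝ≥0∞} [Fact (1 ≤ q')] {η : Ω → Space d} {K : ℝ}
    (hK : ∀ᵐ ω ∂P, lqNorm q' (η ω) ≤ K) (z : Space d) :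
    ∀ᵐ ω ∂P, lqNorm q (η ω - z) ≤ essSup (fun ω => lqNorm q (η ω - z)) P := by
  obtain ⟨C, hC0, hC⟩ := exists_norm_le_mul_lqNorm (d := d) q'
  obtain ⟨C', hC0', hC'⟩ := exists_lqNorm_le_mul_norm (d := d) q
  refine ae_le_essSup (isBoundedUnder_of_eventually_le (a := C' * (C * K) + lqNorm q z) ?_)
  filter_upwards [hK] with ω hω
  refine (lqNorm_sub_le q _ _).trans ?_
  gcongr
  exact (hC' _).trans (by gcongr; exact (hC _).trans (by gcongr))

end Wasserstein
end ProbFlow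

/-! ### The theorem -/

theorem theorem2p4 {d : ℕ} {Ω : Type*} [MeasurableSpace Ω] (P : Measure Ω) [IsProbabilityMeasure P]
    (T : EReal) (hT : 0 < T) (σ : ℝ → ℝ) (hσ : HypH T σ)
    (μ₀ : Measure (Space d)) [IsProbabilityMeasure μ₀]
    (Y₀ η : Ω → Space d) (hY₀ : IsStdNormal P Y₀)
    (hη : Measurable η) (hη_law : P.map η = μ₀) (hindep : IndepFun η Y₀ P)
    (q : ℝ≥0∞) (hq : 1 ≤ q) (K : ℝ) (hK : ∀ᵐ ω ∂P, lqNorm q (η ω) ≤ K) :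
    ∃ Y : ℝ → Ω → Space d,
      -- existence and pathwise uniqueness on `[0, T)`
      (∀ ω, IsSolution T σ μ₀ (Y₀ ω) (fun t => Y t ω)) ∧
      (∀ ω (y : ℝ → Space d), IsSolution T σ μ₀ (Y₀ ω) y →
        EqOn y (fun t => Y t ω) (timeInterval T)) ∧
      ∀ t ∈ timeInterval T,
        Measurable (Y t) ∧
        -- the law of `Y_t` has density `φ_t`
        P.map (Y t) = volume.withDensity (fun x => ENNReal.ofReal (phi σ μ₀ t x)) ∧
        -- and it is the law of `β_t η + σ_t ξ`
        (∀ ξ : Ω → Space d, IsStdNormal P ξ → IndepFun η ξ P →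
          P.map (Y t) = P.map (fun ω => beta σ t • η ω + σ t • ξ ω)) ∧
        -- the Wasserstein estimate
        (∀ p : ℝ, 1 ≤ p →
          Integrable (fun ω => lqNorm q (Y₀ ω) ^ p) P ∧
          wasserstein q p (P.map (Y t)) μ₀ ≤
            ENNReal.ofReal ((K + (∫ ω, lqNorm q (Y₀ ω) ^ p ∂P) ^ (1 / p)) * σ t)) ∧
        -- the pathwise estimate
        (∀ (z : Space d) (ω : Ω),
          lqNorm q (Y t ω - beta σ t • z) ≤
            σ t * lqNorm q (Y₀ ω) +
              beta σ t * essSup (fun ω' => lqNorm q (η ω' - z)) P) ∧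
        -- the tail estimate
        (∀ M : ℝ, 0 < M →
          P.real {ω | beta σ t * essSup (fun ω' => lqNorm ∞ (η ω')) P + σ t * M ≤
              lqNorm ∞ (Y t ω)} ≤
            1 - (1 - erfc (M / √2)) ^ d) := by
  have : Fact (1 ≤ q) := ⟨hq⟩
  have transfer : ∀ (r : ℝ≥0∞) [Fact (1 ≤ r)] (z : Space d), ∀ᵐ y ∂μ₀,
      lqNorm r (y - z) ≤ essSup (fun ω => lqNorm r (η ω - z)) P := by
    intro r _ z
    rw [← hη_law]
    refine (ae_map_iff hη.aemeasurable ?_).2 (lqNorm_sub_le_essSup r hK z)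
    exact ((continuous_lqNorm r).measurable.comp (by fun_prop)) measurableSet_Iic
  obtain ⟨R, hR⟩ : ∃ R : ℝ, ∀ᵐ y ∂μ₀, ‖y‖ ≤ R := by
    obtain ⟨C, hC0, hC⟩ := exists_norm_le_mul_lqNorm (d := d) q
    refine ⟨C * essSup (fun ω => lqNorm q (η ω - 0)) P, (transfer q 0).mono fun y hy => ?_⟩
    rw [sub_zero] at hy
    exact (hC y).trans (by gcongr)
  obtain ⟨Φ, hΦ⟩ := exists_tiltMean_flow hR
  have hsol := fun ω => isSolution_smul_flow hσ hT hΦ (Y₀ ω)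
  refine ⟨fun t ω => σ t • Φ 0 (Y₀ ω) (beta σ t / σ t), hsol,
    fun ω y hy => isSolution_unique hσ hT hR hy (hsol ω), fun t ht => ?_⟩
  have hσt := hσ.pos ht
  have hβt := hσ.beta_nonneg hT ht
  have hdens : P.map (fun ω => σ t • Φ 0 (Y₀ ω) (beta σ t / σ t)) =
      volume.withDensity fun x => ENNReal.ofReal (gaussMix μ₀ (σ t) (beta σ t) x) := by
    rw [map_smul_flow_eq hR hΦ hY₀ hσt, mul_div_cancel₀ _ hσt.ne']
  have hlaw : ∀ ξ : Ω → Space d, IsStdNormal P ξ → IndepFun η ξ P →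
      P.map (fun ω => σ t • Φ 0 (Y₀ ω) (beta σ t / σ t)) =
        P.map (fun ω => beta σ t • η ω + σ t • ξ ω) := fun ξ hξ hi =>
    hdens.trans (map_add_stdNormal_eq μ₀ hη hη_law hξ hi hσt _).symm
  have hpath : ∀ (r : ℝ≥0∞) [Fact (1 ≤ r)] (z : Space d) (ω : Ω),
      lqNorm r (σ t • Φ 0 (Y₀ ω) (beta σ t / σ t) - beta σ t • z) ≤
        σ t * lqNorm r (Y₀ ω) + beta σ t * essSup (fun ω' => lqNorm r (η ω' - z)) P := by
    intro r _ z ω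
    have h1 := lqNorm_flow_sub_le r hR hΦ (transfer r z) (div_nonneg hβt hσt.le) (Y₀ ω)
    have h2 : σ t • Φ 0 (Y₀ ω) (beta σ t / σ t) - beta σ t • z =
        σ t • (Φ 0 (Y₀ ω) (beta σ t / σ t) - (beta σ t / σ t) • z) := by
      rw [smul_sub, smul_smul, mul_div_cancel₀ _ hσt.ne']
    rw [h2, lqNorm_smul, abs_of_pos hσt]
    refine (mul_le_mul_of_nonneg_left h1 hσt.le).trans_eq ?_
    field_simp
  refine ⟨?_, hdens, hlaw, fun p hp => ⟨hY₀.integrable_lqNorm_rpow q (one_pos.trans_le hp), ?_⟩,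
    hpath q, fun M hM => ?_⟩
  · have h1 : Measurable fun ω => Φ 0 (Y₀ ω) (beta σ t / σ t) :=
      (continuous_flow hR hΦ 0 _).measurable.comp hY₀.measurable
    exact h1.const_smul (σ t)
  · have := wasserstein_convex_combination_le q hY₀ hη hK hσt.le hp
    rw [hη_law] at this
    -- The choice ξ = Y₀ realizes μ_t on the space that carries η.
    rwa [hlaw Y₀ hY₀ hindep]
  -- By the pathwise bound with z = 0, the event is contained in {‖Y₀‖_∞ ≥ M}, whose probability is
  -- the right-hand side.
  · rw [← hY₀.measureReal_le_lqNorm_top hM]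
    refine measureReal_mono fun ω hω => ?_
    have h1 := hpath ∞ 0 ω
    simp only [smul_zero, sub_zero] at h1
    have h2 : σ t * M ≤ σ t * lqNorm ∞ (Y₀ ω) := by
      have h3 : beta σ t * essSup (fun ω' => lqNorm ∞ (η ω')) P + σ t * M ≤
        lqNorm ∞ (σ t • Φ 0 (Y₀ ω) (beta σ t / σ t)) := hω
      linarith
    exact le_of_mul_le_mul_left h2 hσt
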